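/- Let $\operatorname{sign}(y)=1$ if $y\ge 0$ and $\operatorname{sign}(y)=-1$ if $y<0$, and let $F:\mathbb R^2\to\mathbb R^2$ be the map $$F(x,y)=\begin{pmatrix}\cos\alpha&\sin\alpha\\-\sin\alpha&\cos\alpha\end{pmatrix}\begin{pmatrix}x-\operatorname{sign}(y)\\y\end{pmatrix}\qquad\text{with }\alpha=\pi/3 .$$ Its critical set is $\mathcal F=\bigcup_{i\ge 0}\{(x,y): F^i(x,y)\in LC_0\}$, where $LC_0=\{y=0\}$. The lines $y=\sqrt3(x-2k-1)$, $y=\sqrt3\,\ell$, $y=-\sqrt3(x-2m)$ with $k,\ell,m\in\mathbb Z$ form a trihexagonal tiling of the plane with tiles $$T_{k,\ell,m}=\{\sqrt3(x-2k-1)<y<\sqrt3(x-2k+1),\ \sqrt3\,\ell<y<\sqrt3(\ell+1),\ -\sqrt3(x-2m)<y<-\sqrt3(x-2m-2)\};$$ $T_{k,\ell,k+\ell}$ is a regular hexagon with center $p_{k,\ell}=(2k+\ell+\tfrac12,\sqrt3\,\ell+\tfrac{\sqrt3}2)$, $T_{k,\ell,k+\ell\pm1}$ are equilateral triangles, and the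 other $T_{k,\ell,m}$ are empty. The energy is $$V=\max\big(|B-C+D|,\ |B+C+D+1|-1,\ |-B+C+D+1|-1\big),$$ where $B=\lfloor(3x-\sqrt3y+3)/6\rfloor$, $C=\lfloor\sqrt3y/3\rfloor$, $D=\lfloor(3x+\sqrt3y)/6\rfloor$. For each integer $k\ge0$ there are exactly $12k+2$ hexagons of energy level $V=4k$. Let $X_1$ be the one among their centers that lies in the upper half plane $\{y\geq 0\}$ and has smallest first coordinate there, namely $X_1=(-4k+\frac12,\frac{\sqrt3}2)$, and let $X_1,X_2,\dots,X_{12k+2}$ be all these centers, numbered consecutively in clockwise sense along the hexagonal ring that they form. The closed hexagons with centers $X_1,X_3,\dots,X_{12k+1}$ are called the perfect hexagons with energy level $4k$. An edge (vertex) of a tile is called non-perfect if it is not an edge (vertex) of any perfect hexagon. **Theorem.** Every point of $\mathcal F$ is a periodic point of $F$. Furthermore (periods are minimal periods): (a) every point of an edge (endpoints included) of a perfect hexagon with energy level $V=4k$, $k\ge0$, is periodic with period $36k+6$; (b) every point of a non-perfect open edge of a tile is periodic with period $108k+72$ for some integer $k\ge0$; (c) every non-perfect vertex of a tile is periodic with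 period $18k+9$ or $18k+15$ for some integer $k\ge0$. -/

import Mathlib

namespace PiecewiseRotation

/-- The sign convention `sign y = 1` for `y ≥ 0` and `sign y = -1` for `y < 0`. -/
noncomputable def sgn (y : ℝ) : ℝ := if 0 ≤ y then 1 else -1

/-- The map `F(x,y) = R (x - sign y, y)ᵗ`, where `R` is the matrix
`(cos α, sin α; -sin α, cos α)`. -/
noncomputable def F (α : ℝ) (p : ℝ × ℝ) : ℝ × ℝ :=
  (Real.cos α * (p.1 - sgn p.2) + Real.sin α * p.2,
    -Real.sin α * (p.1 - sgn p.2) + Real.cos α * p.2)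

/-- The critical line `LC₀ = {y = 0}`. -/
def criticalLine : Set (ℝ × ℝ) := {p | p.2 = 0}

/-- The critical set: the union of all preimages `LC₋ᵢ = (Fⁱ)⁻¹(LC₀)`, `i ≥ 0`. -/
def criticalSet (α : ℝ) : Set (ℝ × ℝ) := ⋃ i : ℕ, (F α)^[i] ⁻¹' criticalLine

/-! ### The trihexagonal tiling -/

/-- The line `y = √3 (x - 2k - 1)`. -/
noncomputable def lineUp (k : ℤ) : Set (ℝ × ℝ) := {p | p.2 = √3 * (p.1 - 2 * k - 1)}

/-- The line `y = √3 ℓ`. -/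
noncomputable def lineHor (l : ℤ) : Set (ℝ × ℝ) := {p | p.2 = √3 * l}

/-- The line `y = -√3 (x - 2m)`. -/
noncomputable def lineDown (m : ℤ) : Set (ℝ × ℝ) := {p | p.2 = -√3 * (p.1 - 2 * m)}

/-- The lines of the grid. -/
def IsGridLine (L : Set (ℝ × ℝ)) : Prop :=
  (∃ k : ℤ, L = lineUp k) ∨ (∃ l : ℤ, L = lineHor l) ∨ (∃ m : ℤ, L = lineDown m)

/-- The tile with index `(k, ℓ, m)`, including its boundary. It is a regular hexagon if
`m = k + ℓ`, an equilateral triangle if `m = k + ℓ - 1` or `m = k + ℓ + 1`, and empty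
otherwise. -/
def closedTile (k l m : ℤ) : Set (ℝ × ℝ) :=
  {p | √3 * (p.1 - 2 * k - 1) ≤ p.2 ∧ p.2 ≤ √3 * (p.1 - 2 * k + 1) ∧
    √3 * l ≤ p.2 ∧ p.2 ≤ √3 * (l + 1) ∧
    -√3 * (p.1 - 2 * m) ≤ p.2 ∧ p.2 ≤ -√3 * (p.1 - 2 * m - 2)}

/-- `e` is an edge, with its two endpoints, of the tile with index `(k, ℓ, m)`. Grid lines do
not cross the interior of a tile, so a grid line meets a closed tile in an edge, in one vertex,
or not at all. -/
def IsEdge (k l m : ℤ) (e : Set (ℝ × ℝ)) : Prop :=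
  ∃ L, IsGridLine L ∧ e = closedTile k l m ∩ L ∧ e.Nontrivial

/-- `p` is a vertex of the tile with index `(k, ℓ, m)`: a point of the closed tile where two
distinct grid lines cross. -/
def IsVertex (k l m : ℤ) (p : ℝ × ℝ) : Prop :=
  p ∈ closedTile k l m ∧ ∃ L L', IsGridLine L ∧ IsGridLine L' ∧ L ≠ L' ∧ p ∈ L ∧ p ∈ L'

/-- The open edge of a tile: the edge without the vertices of the tile. -/
def openEdge (k l m : ℤ) (e : Set (ℝ × ℝ)) : Set (ℝ × ℝ) := {p ∈ e | ¬ IsVertex k l m p}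

/-! ### The first integral and the perfect hexagons -/

/-- `B(x,y) = ⌊(3x - √3 y + 3)/6⌋`. -/
noncomputable def B (p : ℝ × ℝ) : ℤ := ⌊(3 * p.1 - √3 * p.2 + 3) / 6⌋

/-- `C(y) = ⌊√3 y/3⌋`. -/
noncomputable def C (p : ℝ × ℝ) : ℤ := ⌊√3 * p.2 / 3⌋

/-- `D(x,y) = ⌊(3x + √3 y)/6⌋`. -/
noncomputable def D (p : ℝ × ℝ) : ℤ := ⌊(3 * p.1 + √3 * p.2) / 6⌋

/-- The first integral `V`, the energy. -/
noncomputable def V (p : ℝ × ℝ) : ℤ :=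
  max |B p - C p + D p| (max (|B p + C p + D p + 1| - 1) (|-B p + C p + D p + 1| - 1))

/-- The center of the hexagon with index `(k, ℓ, k + ℓ)`. -/
noncomputable def hexCenter (k l : ℤ) : ℝ × ℝ := (2 * k + l + 1 / 2, √3 * l + √3 / 2)

/-- For `h ≥ 0` and `1 ≤ i ≤ 6h + 2`, the pair `(k, ℓ)` such that `hexCenter k ℓ` is the `i`-th
center `Xᵢ` of the hexagons of level `c = 2h` (there are `3c + 2 = 6h + 2` of them). `X₁` is the
center in the upper half plane with smallest first coordinate, `X₁ = (-c + 1/2, √3/2)`, and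
the numbering runs clockwise along the (irregular) hexagonal ring formed by the centers, whose
six sides are, in this order,
`k = -h`, `ℓ = h`, `k + ℓ = h`, `k = h`, `ℓ = -h - 1`, `k + ℓ = -h - 1`. -/
def hexLabel (h i : ℤ) : ℤ × ℤ :=
  if i ≤ h + 1 then (-h, i - 1)
  else if i ≤ 2 * h + 1 then (i - 1 - 2 * h, h)
  else if i ≤ 3 * h + 1 then (i - 1 - 2 * h, 3 * h + 1 - i)
  else if i ≤ 4 * h + 2 then (h, 3 * h + 1 - i)
  else if i ≤ 5 * h + 2 then (5 * h + 2 - i, -h - 1)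
  else (5 * h + 2 - i, i - 6 * h - 3)

/-- The hexagon with index `(k, ℓ, k + ℓ)` is a perfect hexagon with energy level `4n`: it lies on
level `V = 4n`, and it is one of the hexagons centered at `X₁, X₃, …, X₁₂ₙ₊₁` among the
`12n + 2` hexagons of this level. -/
def IsPerfectHexagon (n : ℕ) (k l : ℤ) : Prop :=
  V (hexCenter k l) = 4 * n ∧
    ∃ i : ℤ, 1 ≤ i ∧ i ≤ 12 * n + 1 ∧ Odd i ∧ hexLabel (2 * n) i = (k, l)

/-- `e` is an edge of some perfect hexagon. -/
def IsPerfectEdge (e : Set (ℝ × ℝ)) : Prop :=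
  ∃ (n : ℕ) (k l : ℤ), IsPerfectHexagon n k l ∧ IsEdge k l (k + l) e

/-- `p` is a vertex of some perfect hexagon. -/
def IsPerfectVertex (p : ℝ × ℝ) : Prop :=
  ∃ (n : ℕ) (k l : ℤ), IsPerfectHexagon n k l ∧ IsVertex k l (k + l) p

end PiecewiseRotation

namespace PiecewiseRotation

/-! ### Lattice coordinates -/

/-! In suitable lattice coordinates the grid lines are `v ∈ ℤ`, `d ∈ ℤ` and `d - v ∈ ℤ + 1/2`, and
preimages of grid lines lie in grid lines; hence the critical set lies in the grid. A grid point is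
a hexagon plus an offset `w`. The map turns `w` by a sixth of a turn (`rot`, of order 6) and
advances the hexagon by `h` places along its ring of `6h + 2` hexagons (`ringHex_add`). This fails
only on the top edge of the two hexagons of a ring just below the critical line, at indices `0` and
`3h + 2`; there the orbit passes to a neighbouring ring (`latticeMap_hexPoint_exit`).

Perfect hexagons have `h = 2n` and odd index. The index stays odd while both exit indices are even,
so the closed hexagon moves rigidly, and six-fold rotation combined with `6n + 1` places gives `36n
+ 6` (`minimalPeriod_perfect`).

Points of the remaining open edges run through four exits, left `2n`, left `2n + 1`, right `2n + 2`,
right `2n + 1`, and back; the travel times add up to `108n + 72` (`minimalPeriod_leftExit`).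
Congruences place every such point on one of these four stretches.

Every vertex reaches a point with integer coordinates, where the third iterate acts. The non-perfect
ones form closed walks of odd length `N = 6n + 3` or `6n + 5`, on which the third iterate shifts by
the inverse of `2` modulo `N`; the period is `3N` (`minimalPeriod_vertexWalk`). -/

/-- The map `F` in the coordinates `v = y/√3`, `d = (x + y/√3)/2`. -/
noncomputable def latticeMap (q : ℝ × ℝ) : ℝ × ℝ := (q.1 - q.2 + sgn q.1 / 2, q.1)

/-- The coordinates `v = y/√3`, `d = (x + y/√3)/2`. -/
noncomputable def toLattice (p : ℝ × ℝ) : ℝ × ℝ := (p.2 / √3, (p.1 + p.2 / √3) / 2)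

/-- The point with given lattice coordinates. -/
noncomputable def ofLattice (q : ℝ × ℝ) : ℝ × ℝ := (2 * q.2 - q.1, √3 * q.1)

theorem sqrt_three_pos : 0 < √(3 : ℝ) := Real.sqrt_pos.2 (by norm_num)

theorem ofLattice_toLattice (p : ℝ × ℝ) : ofLattice (toLattice p) = p := by
  have := sqrt_three_pos.ne'
  ext
  · simp [ofLattice, toLattice]; ring
  · simp [ofLattice, toLattice]; field_simp

theorem toLattice_ofLattice (q : ℝ × ℝ) : toLattice (ofLattice q) = q := by
  have := sqrt_three_pos.ne'
  ext
  · simp [ofLattice, toLattice]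
  · simp [ofLattice, toLattice]

theorem sgn_sqrt_three_mul (v : ℝ) : sgn (√3 * v) = sgn v := by
  unfold sgn
  simp only [mul_nonneg_iff_of_pos_left sqrt_three_pos]

theorem F_ofLattice (q : ℝ × ℝ) : F (Real.pi / 3) (ofLattice q) = ofLattice (latticeMap q) := by
  have h3 : √(3 : ℝ) * √3 = 3 := Real.mul_self_sqrt (by norm_num)
  ext
  · simp only [F, ofLattice, latticeMap, sgn_sqrt_three_mul, Real.cos_pi_div_three,
      Real.sin_pi_div_three]
    linear_combination (q.1 / 2) * h3
  · simp only [F, ofLattice, latticeMap, sgn_sqrt_three_mul, Real.cos_pi_div_three,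
      Real.sin_pi_div_three]
    ring

theorem iterate_F_ofLattice (n : ℕ) (q : ℝ × ℝ) :
    (F (Real.pi / 3))^[n] (ofLattice q) = ofLattice (latticeMap^[n] q) := by
  induction n generalizing q with
  | zero => rfl
  | succ n ih => rw [Function.iterate_succ_apply, Function.iterate_succ_apply, F_ofLattice, ih]

theorem ofLattice_injective : Function.Injective ofLattice :=
  Function.LeftInverse.injective toLattice_ofLattice

/-! ### Transfer of minimal periods. -/

theorem minimalPeriod_F (p : ℝ × ℝ) :
    Function.minimalPeriod (F (Real.pi / 3)) p =
      Function.minimalPeriod latticeMap (toLattice p) := by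
  rw [← ofLattice_toLattice p, Function.minimalPeriod_eq_minimalPeriod_iff]
  intro n
  rw [toLattice_ofLattice]
  unfold Function.IsPeriodicPt Function.IsFixedPt
  rw [iterate_F_ofLattice]
  exact ofLattice_injective.eq_iff

theorem latticeMap_injective : Function.Injective latticeMap := by
  rintro ⟨v, d⟩ ⟨v', d'⟩ h
  simp only [latticeMap, Prod.mk.injEq] at h
  obtain ⟨h1, rfl⟩ := h
  ext
  · rfl
  · simp only; linarith

theorem minimalPeriod_iterate_of_injective {X : Type*} {f : X → X} (hf : Function.Injective f)
    (t : ℕ) (x : X) : Function.minimalPeriod f (f^[t] x) = Function.minimalPeriod f x := by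
  rw [Function.minimalPeriod_eq_minimalPeriod_iff]
  intro n
  unfold Function.IsPeriodicPt Function.IsFixedPt
  rw [← Function.iterate_add_apply, add_comm, Function.iterate_add_apply]
  exact (hf.iterate t).eq_iff

theorem minimalPeriod_eq_of_forall {X : Type*} {f : X → X} {x : X} {N : ℕ} (hN : 0 < N)
    (h : Function.IsPeriodicPt f N x)
    (h' : ∀ t, 0 < t → t < N → ¬ Function.IsPeriodicPt f t x) :
    Function.minimalPeriod f x = N := by
  refine le_antisymm (h.minimalPeriod_le hN) (not_lt.1 fun hlt => ?_)
  exact h' _ (h.minimalPeriod_pos hN) hlt (Function.isPeriodicPt_minimalPeriod f x)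

/-! ### The tiling in lattice coordinates -/

theorem mem_closedTile_iff {k l m : ℤ} {p : ℝ × ℝ} : p ∈ closedTile k l m ↔
    (l ≤ (toLattice p).1 ∧ (toLattice p).1 ≤ l + 1) ∧
    (m ≤ (toLattice p).2 ∧ (toLattice p).2 ≤ m + 1) ∧
    (k - 1 / 2 ≤ (toLattice p).2 - (toLattice p).1 ∧
      (toLattice p).2 - (toLattice p).1 ≤ k + 1 / 2) := by
  obtain ⟨⟨v, d⟩, rfl⟩ : ∃ q, ofLattice q = p := ⟨_, ofLattice_toLattice p⟩
  have h3 := sqrt_three_pos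
  rw [toLattice_ofLattice]
  simp only [closedTile, ofLattice, Set.mem_ofPred_eq, neg_mul, ← mul_neg,
    mul_le_mul_iff_right₀ h3]
  constructor
  · rintro ⟨h1, h2, h3, h4, h5, h6⟩
    refine ⟨⟨h3, h4⟩, ⟨?_, ?_⟩, ?_, ?_⟩ <;> linarith
  · rintro ⟨⟨h3, h4⟩, ⟨h1, h2⟩, h5, h6⟩
    refine ⟨?_, ?_, h3, h4, ?_, ?_⟩ <;> linarith

theorem mem_lineUp_iff {k : ℤ} {p : ℝ × ℝ} :
    p ∈ lineUp k ↔ (toLattice p).2 - (toLattice p).1 = k + 1 / 2 := by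
  obtain ⟨⟨v, d⟩, rfl⟩ : ∃ q, ofLattice q = p := ⟨_, ofLattice_toLattice p⟩
  rw [toLattice_ofLattice]
  simp only [lineUp, ofLattice, Set.mem_ofPred_eq, mul_right_inj' sqrt_three_pos.ne']
  constructor <;> intro h <;> linarith

theorem mem_lineHor_iff {l : ℤ} {p : ℝ × ℝ} : p ∈ lineHor l ↔ (toLattice p).1 = l := by
  obtain ⟨⟨v, d⟩, rfl⟩ : ∃ q, ofLattice q = p := ⟨_, ofLattice_toLattice p⟩
  rw [toLattice_ofLattice]
  simp only [lineHor, ofLattice, Set.mem_ofPred_eq, mul_right_inj' sqrt_three_pos.ne']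

theorem mem_lineDown_iff {m : ℤ} {p : ℝ × ℝ} : p ∈ lineDown m ↔ (toLattice p).2 = m := by
  obtain ⟨⟨v, d⟩, rfl⟩ : ∃ q, ofLattice q = p := ⟨_, ofLattice_toLattice p⟩
  rw [toLattice_ofLattice]
  simp only [lineDown, ofLattice, Set.mem_ofPred_eq, neg_mul, ← mul_neg,
    mul_right_inj' sqrt_three_pos.ne']
  constructor <;> intro h <;> linarith

theorem lineHor_ne_lineDown (l m : ℤ) : lineHor l ≠ lineDown m := by
  intro h
  have := Set.ext_iff.1 h (ofLattice (l, m + 1))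
  simp [mem_lineHor_iff, mem_lineDown_iff, toLattice_ofLattice] at this

theorem lineHor_ne_lineUp (l k : ℤ) : lineHor l ≠ lineUp k := by
  intro h
  have := Set.ext_iff.1 h (ofLattice (l, l + k))
  simp [mem_lineHor_iff, mem_lineUp_iff, toLattice_ofLattice] at this

theorem lineDown_ne_lineUp (m k : ℤ) : lineDown m ≠ lineUp k := by
  intro h
  have := Set.ext_iff.1 h (ofLattice (m - k, m))
  simp [mem_lineDown_iff, mem_lineUp_iff, toLattice_ofLattice] at this

/-- The point with lattice coordinates `q` lies on two grid lines. -/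
def IsCrossing (q : ℝ × ℝ) : Prop :=
  (∃ l m : ℤ, q.1 = l ∧ q.2 = m) ∨ (∃ l k : ℤ, q.1 = l ∧ q.2 - q.1 = k + 1 / 2) ∨
    (∃ m k : ℤ, q.2 = m ∧ q.2 - q.1 = k + 1 / 2)

theorem isVertex_iff {k l m : ℤ} {p : ℝ × ℝ} :
    IsVertex k l m p ↔ p ∈ closedTile k l m ∧ IsCrossing (toLattice p) := by
  refine and_congr_right fun _ => ⟨?_, ?_⟩
  · rintro ⟨L, L', ⟨a, rfl⟩ | ⟨a, rfl⟩ | ⟨a, rfl⟩, ⟨b, rfl⟩ | ⟨b, rfl⟩ | ⟨b, rfl⟩, hne, h1, h2⟩ <;>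
    simp only [mem_lineUp_iff, mem_lineHor_iff, mem_lineDown_iff] at h1 h2
    · rw [h1] at h2
      have : a = b := by exact_mod_cast (add_left_inj _).1 h2
      exact absurd (this ▸ rfl) hne
    · exact .inr (.inl ⟨_, _, h2, h1⟩)
    · exact .inr (.inr ⟨_, _, h2, h1⟩)
    · exact .inr (.inl ⟨_, _, h1, h2⟩)
    · rw [h1] at h2
      have : a = b := by exact_mod_cast h2
      exact absurd (this ▸ rfl) hne
    · exact .inl ⟨_, _, h1, h2⟩
    · exact .inr (.inr ⟨_, _, h1, h2⟩)
    · exact .inl ⟨_, _, h2, h1⟩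
    · rw [h1] at h2
      have : a = b := by exact_mod_cast h2
      exact absurd (this ▸ rfl) hne
  · rintro (⟨a, b, h1, h2⟩ | ⟨a, b, h1, h2⟩ | ⟨a, b, h1, h2⟩)
    · exact ⟨_, _, .inr (.inl ⟨a, rfl⟩), .inr (.inr ⟨b, rfl⟩), lineHor_ne_lineDown _ _,
        mem_lineHor_iff.2 h1, mem_lineDown_iff.2 h2⟩
    · exact ⟨_, _, .inr (.inl ⟨a, rfl⟩), .inl ⟨b, rfl⟩, lineHor_ne_lineUp _ _,
        mem_lineHor_iff.2 h1, mem_lineUp_iff.2 h2⟩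
    · exact ⟨_, _, .inr (.inr ⟨a, rfl⟩), .inl ⟨b, rfl⟩, lineDown_ne_lineUp _ _,
        mem_lineDown_iff.2 h1, mem_lineUp_iff.2 h2⟩

theorem int_eq_of_mem_interval {a b : ℤ} {t : ℝ} (h : ∀ c : ℤ, t ≠ c) (h1 : a ≤ t)
    (h2 : t ≤ a + 1) (h3 : b ≤ t) (h4 : t ≤ b + 1) : a = b := by
  have e1 := lt_of_le_of_ne h1 (h a).symm
  have e2 := lt_of_le_of_ne h3 (h b).symm
  have : (a : ℝ) < b + 1 := by linarith
  have h5 : a < b + 1 := by exact_mod_cast this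
  have : (b : ℝ) < a + 1 := by linarith
  have h6 : b < a + 1 := by exact_mod_cast this
  omega

/-- Two closed tiles that share a point of a grid line which is not a vertex have the same
intersection with this line. -/
theorem closedTile_inter_subset {k l m k' l' m' : ℤ} {p : ℝ × ℝ} {L : Set (ℝ × ℝ)}
    (hL : IsGridLine L) (hp : p ∈ L) (hv : ¬ IsCrossing (toLattice p))
    (h : p ∈ closedTile k l m) (h' : p ∈ closedTile k' l' m') :
    closedTile k l m ∩ L ⊆ closedTile k' l' m' ∩ L := by
  rintro q ⟨hq, hqL⟩
  refine ⟨?_, hqL⟩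
  rw [mem_closedTile_iff] at *
  obtain ⟨⟨a1, a2⟩, ⟨a3, a4⟩, a5, a6⟩ := h
  obtain ⟨b1, b2, b3⟩ := h'
  obtain ⟨⟨c1, c2⟩, ⟨c3, c4⟩, c5, c6⟩ := hq
  have half : ∀ c : ℤ, (toLattice p).2 - (toLattice p).1 + 1 / 2 = c →
      (toLattice p).2 - (toLattice p).1 = (c - 1 : ℤ) + 1 / 2 := by
    intro c hc; push_cast; linarith
  obtain ⟨a, rfl⟩ | ⟨a, rfl⟩ | ⟨a, rfl⟩ := hL
  · rw [mem_lineUp_iff] at hp hqL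
    -- Since `p` is on no other grid line, it determines the two strips transverse to `L`. The
    -- coordinate of the third strip is constant on `L`, so its inequalities at `q` are those at
    -- `p`.
    have hl : l = l' := int_eq_of_mem_interval
      (fun c hc => hv (.inr (.inl ⟨c, a, hc, hp⟩))) a1 a2 b1.1 b1.2
    have hm : m = m' := int_eq_of_mem_interval
      (fun c hc => hv (.inr (.inr ⟨c, a, hc, hp⟩))) a3 a4 b2.1 b2.2
    subst hl hm
    rw [hqL, ← hp]
    exact ⟨⟨c1, c2⟩, ⟨c3, c4⟩, b3⟩
  · rw [mem_lineHor_iff] at hp hqL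
    have hk : k = k' := int_eq_of_mem_interval (t := (toLattice p).2 - (toLattice p).1 + 1 / 2)
      (fun c hc => hv (.inr (.inl ⟨a, _, hp, half c hc⟩))) (by linarith) (by linarith)
      (by linarith [b3.1]) (by linarith [b3.2])
    have hm : m = m' := int_eq_of_mem_interval
      (fun c hc => hv (.inl ⟨a, c, hp, hc⟩)) a3 a4 b2.1 b2.2
    subst hk hm
    refine ⟨?_, ⟨c3, c4⟩, c5, c6⟩
    rw [hqL, ← hp]
    exact b1
  · rw [mem_lineDown_iff] at hp hqL
    have hl : l = l' := int_eq_of_mem_interval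
      (fun c hc => hv (.inl ⟨c, a, hc, hp⟩)) a1 a2 b1.1 b1.2
    have hk : k = k' := int_eq_of_mem_interval (t := (toLattice p).2 - (toLattice p).1 + 1 / 2)
      (fun c hc => hv (.inr (.inr ⟨a, _, hp, half c hc⟩))) (by linarith) (by linarith)
      (by linarith [b3.1]) (by linarith [b3.2])
    subst hl hk
    refine ⟨⟨c1, c2⟩, ?_, c5, c6⟩
    rw [hqL, ← hp]
    exact b2


/-! ### Rings of hexagons -/

/-- The hexagons of the ring of level `2h`, numbered periodically. -/
def ringHex (h i : ℤ) : ℤ × ℤ := hexLabel h ((i - 1) % (6 * h + 2) + 1)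

/-- The image of a hexagon under the map. -/
def nextHex (c : ℤ × ℤ) : ℤ × ℤ :=
  if 0 ≤ c.2 then (c.1 + c.2, -c.1) else (c.1 + c.2 + 1, -c.1 - 1)

theorem hexLabel_cases (h i : ℤ) :
    (i ≤ h + 1 ∧ (hexLabel h i).1 = -h ∧ (hexLabel h i).2 = i - 1) ∨
    (h + 1 < i ∧ i ≤ 2 * h + 1 ∧ (hexLabel h i).1 = i - 1 - 2 * h ∧ (hexLabel h i).2 = h) ∨
    (h + 1 < i ∧ 2 * h + 1 < i ∧ i ≤ 3 * h + 1 ∧ (hexLabel h i).1 = i - 1 - 2 * h ∧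
      (hexLabel h i).2 = 3 * h + 1 - i) ∨
    (h + 1 < i ∧ 2 * h + 1 < i ∧ 3 * h + 1 < i ∧ i ≤ 4 * h + 2 ∧ (hexLabel h i).1 = h ∧
      (hexLabel h i).2 = 3 * h + 1 - i) ∨
    (h + 1 < i ∧ 2 * h + 1 < i ∧ 3 * h + 1 < i ∧ 4 * h + 2 < i ∧ i ≤ 5 * h + 2 ∧
      (hexLabel h i).1 = 5 * h + 2 - i ∧ (hexLabel h i).2 = -h - 1) ∨
    (h + 1 < i ∧ 2 * h + 1 < i ∧ 3 * h + 1 < i ∧ 4 * h + 2 < i ∧ 5 * h + 2 < i ∧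
      (hexLabel h i).1 = 5 * h + 2 - i ∧ (hexLabel h i).2 = i - 6 * h - 3) := by
  unfold hexLabel
  split_ifs <;> simp_all

theorem ringHex_eq_hexLabel {h i : ℤ} (h1 : 1 ≤ i) (h2 : i ≤ 6 * h + 2) :
    ringHex h i = hexLabel h i := by
  rw [ringHex, Int.emod_eq_of_lt (by omega) (by omega), sub_add_cancel]

theorem ringHex_congr {h i j : ℤ} (hd : 6 * h + 2 ∣ i - j) : ringHex h i = ringHex h j := by
  have : (i - 1) % (6 * h + 2) = (j - 1) % (6 * h + 2) :=
    Int.emod_eq_emod_iff_emod_sub_eq_zero.2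
      (Int.emod_eq_zero_of_dvd (by rwa [sub_sub_sub_cancel_right]))
  rw [ringHex, this, ringHex]

theorem exists_index (h i : ℤ) (hh : 0 ≤ h) :
    ∃ j, 1 ≤ j ∧ j ≤ 6 * h + 2 ∧ 6 * h + 2 ∣ i - j := by
  have h1 := Int.emod_nonneg (i - 1) (show 6 * h + 2 ≠ 0 by omega)
  have h2 := Int.emod_lt_of_pos (i - 1) (show 0 < 6 * h + 2 by omega)
  refine ⟨(i - 1) % (6 * h + 2) + 1, by omega, by omega, ?_⟩
  have := Int.dvd_self_sub_emod (x := i - 1) (m := 6 * h + 2)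
  convert this using 1
  ring

/-- A ring has six sides of about `h` hexagons, and a clockwise sixth of a turn carries each side to
the next. The two surplus hexagons leave a defect: six steps advance by `6h`, which is `-2` modulo
`6h + 2`. -/
theorem ringHex_add {h : ℤ} (hh : 0 ≤ h) (i : ℤ) : ringHex h (i + h) = nextHex (ringHex h i) := by
  obtain ⟨j, h1, h2, h3⟩ := exists_index h i hh
  rw [ringHex_congr h3, ringHex_congr (show 6 * h + 2 ∣ i + h - (j + h) by
    convert h3 using 1; ring), ringHex_eq_hexLabel h1 h2]
  have key : ∀ m, 1 ≤ m → (m = j + h ∨ m = j - 5 * h - 2) → m ≤ 6 * h + 2 →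
      hexLabel h m = nextHex (hexLabel h j) := by
    intro m m1 m2 m3
    have e1 := hexLabel_cases h j
    have e2 := hexLabel_cases h m
    generalize hexLabel h j = c at *
    generalize hexLabel h m = c' at *
    obtain ⟨k, l⟩ := c
    obtain ⟨k', l'⟩ := c'
    dsimp only [nextHex] at *
    split_ifs with hl <;> simp only [Prod.mk.injEq] <;>
    rcases e1 with e1 | e1 | e1 | e1 | e1 | e1 <;> omega
  by_cases hj : j + h ≤ 6 * h + 2
  · rw [ringHex_eq_hexLabel (by omega) hj]
    exact key _ (by omega) (.inl rfl) hj
  · rw [ringHex_congr (show 6 * h + 2 ∣ j + h - (j - 5 * h - 2) by exact ⟨1, by ring⟩),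
      ringHex_eq_hexLabel (by omega) (by omega)]
    exact key _ (by omega) (.inr rfl) (by omega)

theorem snd_ringHex_eq_neg_one {h i : ℤ} (hh : 0 ≤ h) (hi : (ringHex h i).2 = -1) :
    6 * h + 2 ∣ i - (3 * h + 2) ∨ 6 * h + 2 ∣ i := by
  obtain ⟨j, h1, h2, h3⟩ := exists_index h i hh
  rw [ringHex_congr h3, ringHex_eq_hexLabel h1 h2] at hi
  have : j = 3 * h + 2 ∨ j = 6 * h + 2 := by
    have := hexLabel_cases h j
    omega
  obtain rfl | rfl := this
  · exact .inl h3
  · exact .inr ((dvd_sub_left dvd_rfl).1 h3)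

theorem ringHex_zero {h : ℤ} (hh : 0 ≤ h) : ringHex h 0 = (-h, -1) := by
  rw [ringHex_congr (j := 6 * h + 2) ⟨-1, by ring⟩, ringHex_eq_hexLabel (by omega) le_rfl]
  have := hexLabel_cases h (6 * h + 2)
  ext <;> dsimp only <;> omega

theorem ringHex_right {h : ℤ} (hh : 0 ≤ h) : ringHex h (3 * h + 2) = (h, -1) := by
  rw [ringHex_eq_hexLabel (by omega) (by omega)]
  have := hexLabel_cases h (3 * h + 2)
  ext <;> dsimp only <;> omega

/-- The rings fill the plane; the cases are the six sectors cut out by the sides of the rings. -/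
theorem exists_hexLabel (k l : ℤ) :
    ∃ h i, 0 ≤ h ∧ 1 ≤ i ∧ i ≤ 6 * h + 2 ∧ hexLabel h i = (k, l) := by
  have aux : ∀ h i, 0 ≤ h ∧ 1 ≤ i ∧ i ≤ 6 * h + 2 ∧ (hexLabel h i).1 = k ∧ (hexLabel h i).2 = l →
      ∃ h i, 0 ≤ h ∧ 1 ≤ i ∧ i ≤ 6 * h + 2 ∧ hexLabel h i = (k, l) := by
    rintro h i ⟨h0, h1, h2, h3, h4⟩
    exact ⟨h, i, h0, h1, h2, Prod.ext h3 h4⟩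
  by_cases hl : 0 ≤ l
  · by_cases h1 : l ≤ -k
    · exact aux (-k) (l + 1) (by
          have := hexLabel_cases (-k) (l + 1)
          omega)
    · by_cases h2 : k ≤ 0
      · exact aux l (k + 1 + 2 * l) (by
          have := hexLabel_cases l (k + 1 + 2 * l)
          omega)
      · exact aux (k + l) (k + 1 + 2 * (k + l)) (by
          have := hexLabel_cases (k + l) (k + 1 + 2 * (k + l))
          omega)
  · by_cases hk : 0 ≤ k
    · by_cases h1 : -k - 1 ≤ l
      · exact aux k (3 * k + 1 - l) (by
          have := hexLabel_cases k (3 * k + 1 - l)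
          omega)
      · exact aux (-l - 1) (5 * (-l - 1) + 2 - k) (by
          have := hexLabel_cases (-l - 1) (5 * (-l - 1) + 2 - k)
          omega)
    · exact aux (-(k + l + 1)) (5 * (-(k + l + 1)) + 2 - k) (by
          have := hexLabel_cases (-(k + l + 1)) (5 * (-(k + l + 1)) + 2 - k)
          omega)

/-! ### Offsets from the center of a hexagon -/

/-- The point with offset `w` from the center of the hexagon `c`, in lattice coordinates. -/
noncomputable def hexPoint (c : ℤ × ℤ) (w : ℝ × ℝ) : ℝ × ℝ :=
  (c.2 + 1 / 2 + w.1, c.1 + c.2 + 1 / 2 + w.2)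

/-- The linear part of the map. -/
def rot (w : ℝ × ℝ) : ℝ × ℝ := (w.1 - w.2, w.1)

/-- The offset `w` is that of a point of the closed hexagon. -/
def InHex (w : ℝ × ℝ) : Prop :=
  (-(1 / 2) ≤ w.1 ∧ w.1 ≤ 1 / 2) ∧ (-(1 / 2) ≤ w.2 ∧ w.2 ≤ 1 / 2) ∧
    (-(1 / 2) ≤ w.1 - w.2 ∧ w.1 - w.2 ≤ 1 / 2)

theorem InHex.rot {w : ℝ × ℝ} (hw : InHex w) : InHex (rot w) := by
  obtain ⟨⟨h1, h2⟩, ⟨h3, h4⟩, h5, h6⟩ := hw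
  simp only [InHex, PiecewiseRotation.rot]
  refine ⟨⟨h5, h6⟩, ⟨h1, h2⟩, ?_, ?_⟩ <;> linarith

theorem InHex.iterate_rot {w : ℝ × ℝ} (hw : InHex w) (t : ℕ) :
    InHex (PiecewiseRotation.rot^[t] w) := by
  induction t with
  | zero => exact hw
  | succ t ih => rw [Function.iterate_succ_apply']; exact ih.rot

theorem rot_iterate_six (w : ℝ × ℝ) : rot^[6] w = w := by
  ext <;> simp [rot]

theorem rot_iterate_add_six_mul (t s : ℕ) (w : ℝ × ℝ) : rot^[t + 6 * s] w = rot^[t] w := by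
  induction s with
  | zero => rfl
  | succ s ih => rw [mul_add, ← add_assoc, mul_one, Function.iterate_add_apply, rot_iterate_six, ih]

theorem rot_iterate_mod (t : ℕ) (w : ℝ × ℝ) : rot^[t] w = rot^[t % 6] w := by
  conv_lhs => rw [← Nat.mod_add_div t 6, rot_iterate_add_six_mul]

/-- The sign is constant on a closed hexagon unless its top edge lies on `v = 0`, where the
convention `sgn 0 = 1` disagrees with the interior. The hypothesis `hc` removes exactly this edge.
-/
theorem latticeMap_hexPoint {c : ℤ × ℤ} {w : ℝ × ℝ} (hw : InHex w)
    (hc : c.2 = -1 → w.1 ≠ 1 / 2) : latticeMap (hexPoint c w) = hexPoint (nextHex c) (rot w) := by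
  obtain ⟨k, l⟩ := c
  obtain ⟨⟨h1, h2⟩, -⟩ := hw
  dsimp only at hc
  unfold nextHex
  split_ifs with hl
  · have hl' : (0 : ℝ) ≤ l := by exact_mod_cast hl
    have : sgn (l + 1 / 2 + w.1) = 1 := if_pos (by linarith)
    simp only [latticeMap, hexPoint, rot, this, Prod.mk.injEq]
    push_cast
    constructor <;> ring
  · have : sgn (l + 1 / 2 + w.1) = -1 := by
      refine if_neg (not_le.2 ?_)
      by_cases h : l = -1
      · have := lt_of_le_of_ne h2 (hc h)
        rw [h]; push_cast; linarith
      · have : l ≤ -2 := by dsimp only at hl; omega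
        have : (l : ℝ) ≤ -2 := by exact_mod_cast this
        linarith
    simp only [latticeMap, hexPoint, rot, this, Prod.mk.injEq]
    push_cast
    constructor <;> ring

/-- The image hexagon is `nextHex (k - 1, -1)` instead of `nextHex (k, -1)`: the orbit continues as
if it came from the left neighbour, which lies on another ring. -/
theorem latticeMap_hexPoint_exit (k : ℤ) {w : ℝ × ℝ} (hw : w.1 = 1 / 2) :
    latticeMap (hexPoint (k, -1) w) = hexPoint (k - 1, -k) (rot w) := by
  have : sgn (((-1 : ℤ) : ℝ) + 1 / 2 + w.1) = 1 := if_pos (by push_cast; linarith)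
  simp only [latticeMap, hexPoint, rot, this, Prod.mk.injEq]
  push_cast
  constructor <;> ring

/-- As long as the orbit does not meet the top edge of a hexagon below the critical line, it
follows its ring. -/
theorem iterate_hexPoint {h i : ℤ} (hh : 0 ≤ h) {w : ℝ × ℝ} (hw : InHex w) (T : ℕ)
    (H : ∀ t < T, (ringHex h (i + h * t)).2 = -1 → (rot^[t] w).1 ≠ 1 / 2) :
    latticeMap^[T] (hexPoint (ringHex h i) w) = hexPoint (ringHex h (i + h * T)) (rot^[T] w) := by
  induction T with
  | zero => simp
  | succ T ih =>
    rw [Function.iterate_succ_apply', ih fun t ht => H t (by omega),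
      latticeMap_hexPoint (hw.iterate_rot T) (H T (by omega)), ← ringHex_add hh,
      Function.iterate_succ_apply']
    congr 2
    push_cast
    ring


/-! ### Perfect hexagons -/

theorem V_hexCenter (k l : ℤ) :
    V (hexCenter k l) = max |2 * k| (max (|2 * k + 2 * l + 1| - 1) (|2 * l + 1| - 1)) := by
  have h3 : √(3 : ℝ) * √3 = 3 := Real.mul_self_sqrt (by norm_num)
  have e : √3 * (√3 * l + √3 / 2) = 3 * l + 3 / 2 := by linear_combination (l + 1 / 2 : ℝ) * h3
  have hB : B (hexCenter k l) = k := by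
    rw [B, hexCenter, Int.floor_eq_iff]
    dsimp only
    rw [e]
    constructor <;> linarith
  have hC : C (hexCenter k l) = l := by
    rw [C, hexCenter, Int.floor_eq_iff]
    dsimp only
    rw [e]
    constructor <;> linarith
  have hD : D (hexCenter k l) = k + l := by
    rw [D, hexCenter, Int.floor_eq_iff]
    push_cast
    rw [e]
    constructor <;> linarith
  rw [V, hB, hC, hD]
  congr 3 <;> ring_nf

theorem isPerfectHexagon_hexLabel {n : ℕ} {i : ℤ} (h1 : 1 ≤ i) (h2 : i ≤ 12 * n + 1)
    (hi : Odd i) : IsPerfectHexagon n (hexLabel (2 * n) i).1 (hexLabel (2 * n) i).2 := by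
  refine ⟨?_, i, h1, h2, hi, rfl⟩
  rw [V_hexCenter]
  have := hexLabel_cases (2 * n) i
  generalize (hexLabel (2 * n) i).1 = k at *
  generalize (hexLabel (2 * n) i).2 = l at *
  rcases abs_cases (2 * k) with e1 | e1 <;> rcases abs_cases (2 * k + 2 * l + 1) with e2 | e2 <;>
  rcases abs_cases (2 * l + 1) with e3 | e3 <;> rw [e1.1, e2.1, e3.1] <;> omega

theorem isPerfectHexagon_ringHex {n : ℕ} {i : ℤ} (hi : Odd i) :
    IsPerfectHexagon n (ringHex (2 * n) i).1 (ringHex (2 * n) i).2 := by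
  obtain ⟨j, h1, h2, h3⟩ := exists_index (2 * n) i (by omega)
  obtain ⟨q, hq⟩ := h3
  have hj : Odd j := by
    rw [Int.odd_iff] at *
    have : (6 * (2 * (n : ℤ)) + 2) * q = 2 * ((6 * n + 1) * q) := by ring
    omega
  rw [ringHex_congr ⟨q, hq⟩, ringHex_eq_hexLabel h1 h2]
  exact isPerfectHexagon_hexLabel h1 (by rw [Int.odd_iff] at hj; omega) hj

theorem mem_hexagon_iff {k l : ℤ} {p : ℝ × ℝ} :
    p ∈ closedTile k l (k + l) ↔ ∃ w, InHex w ∧ toLattice p = hexPoint (k, l) w := by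
  rw [mem_closedTile_iff]
  constructor
  · rintro ⟨⟨h1, h2⟩, ⟨h3, h4⟩, h5, h6⟩
    push_cast at h3 h4
    refine ⟨((toLattice p).1 - (l + 1 / 2), (toLattice p).2 - (k + l + 1 / 2)), ?_, ?_⟩
    · refine ⟨⟨?_, ?_⟩, ⟨?_, ?_⟩, ?_, ?_⟩ <;> dsimp only <;> linarith
    · ext <;> simp only [hexPoint] <;> ring
  · rintro ⟨w, ⟨⟨h1, h2⟩, ⟨h3, h4⟩, h5, h6⟩, h⟩
    rw [h]
    simp only [hexPoint]
    push_cast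
    refine ⟨⟨?_, ?_⟩, ⟨?_, ?_⟩, ?_, ?_⟩ <;> linarith

theorem six_dvd_of_rot_iterate {w : ℝ × ℝ} (hw : w ≠ 0) {t : ℕ} (h : rot^[t] w = w) : 6 ∣ t := by
  rw [rot_iterate_mod] at h
  obtain ⟨a, b⟩ := w
  have hlt := Nat.mod_lt t (show 6 > 0 by norm_num)
  refine Nat.dvd_of_mod_eq_zero ?_
  generalize t % 6 = r at *
  by_contra hr
  apply hw
  interval_cases r <;> simp [rot] at h hr ⊢ <;> constructor <;> linarith [h.1, h.2]

/-- For `h = 2n` the ring length, the step and both exit indices are even, so an odd index never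
meets an exit. -/
theorem iterate_hexPoint_of_odd {n : ℕ} {i : ℤ} (hi : Odd i) {w : ℝ × ℝ} (hw : InHex w) (T : ℕ) :
    latticeMap^[T] (hexPoint (ringHex (2 * n) i) w) =
      hexPoint (ringHex (2 * n) (i + 2 * n * T)) (rot^[T] w) := by
  refine iterate_hexPoint (by omega) hw T fun t _ ht => ?_
  exfalso
  rw [Int.odd_iff] at hi
  have e : ∀ q : ℤ, (6 * (2 * (n : ℤ)) + 2) * q = 2 * ((6 * n + 1) * q) := fun q => by ring
  have e' : 2 * (n : ℤ) * t = 2 * (n * t) := by ring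
  obtain ⟨q, hq⟩ | ⟨q, hq⟩ := snd_ringHex_eq_neg_one (by omega) ht <;> rw [e, e'] at hq <;> omega

/-- Closed hexagons with a common point have centers differing by at most `1` in each lattice
coordinate. Near the hexagon of index `1` no other odd index qualifies, so a returning point is back
in the same hexagon. -/
theorem ringHex_one_of_near {n : ℕ} {i : ℤ} (hi : Odd i)
    (h1 : |(ringHex (2 * n) i).2| ≤ 1)
    (h3 : |(ringHex (2 * n) i).1 + (ringHex (2 * n) i).2 + 2 * n| ≤ 1) :
    6 * (2 * (n : ℤ)) + 2 ∣ i - 1 := by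
  obtain ⟨j, j1, j2, q, hq⟩ := exists_index (2 * n) i (by omega)
  have hj : Odd j := by
    rw [Int.odd_iff] at *
    have : (6 * (2 * (n : ℤ)) + 2) * q = 2 * ((6 * n + 1) * q) := by ring
    omega
  rw [ringHex_congr ⟨q, hq⟩, ringHex_eq_hexLabel j1 j2, abs_le] at *
  rw [Int.odd_iff] at hj
  have := hexLabel_cases (2 * n) j
  have : j = 1 := by omega
  exact ⟨q, by omega⟩

/-- The center is excluded because `rot` fixes its offset, so its return does not force `6 ∣ T`. -/
theorem minimalPeriod_perfect {n : ℕ} {i : ℤ} (h1 : 1 ≤ i) (hi : Odd i) {w : ℝ × ℝ}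
    (hw : InHex w) (hw0 : w ≠ 0) :
    Function.minimalPeriod latticeMap (hexPoint (ringHex (2 * n) i) w) = 36 * n + 6 := by
  obtain ⟨p, rfl⟩ := hi
  lift p to ℕ using by omega
  -- Six steps change the index by `12n`, which is `-2` modulo `12n + 2`; hence `36n` steps change
  -- it by `-12n`, that is by `2`, and preserve the offset.
  have hp : hexPoint (ringHex (2 * n) (2 * p + 1)) w =
      latticeMap^[36 * n * p] (hexPoint (ringHex (2 * n) 1) w) := by
    rw [iterate_hexPoint_of_odd odd_one hw, rot_iterate_mod,
      show 36 * n * p = 6 * (6 * n * p) by ring, Nat.mul_mod_right]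
    rw [ringHex_congr (j := 1 + 2 * n * (6 * (6 * n * p) : ℕ))
      ⟨p * (1 - 6 * n), by push_cast; ring⟩]
    rfl
  rw [hp, minimalPeriod_iterate_of_injective latticeMap_injective]
  refine minimalPeriod_eq_of_forall (by omega) ?_ ?_
  · unfold Function.IsPeriodicPt Function.IsFixedPt
    rw [iterate_hexPoint_of_odd odd_one hw, rot_iterate_mod,
      show 36 * n + 6 = 6 * (6 * n + 1) by ring, Nat.mul_mod_right]
    rw [ringHex_congr (j := 1) ⟨6 * n, by push_cast; ring⟩]
    rfl
  · intro T hT0 hT h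
    unfold Function.IsPeriodicPt Function.IsFixedPt at h
    rw [iterate_hexPoint_of_odd odd_one hw] at h
    have hone : ringHex (2 * n) 1 = (-(2 * (n : ℤ)), 0) := by
      rw [ringHex_eq_hexLabel le_rfl (by omega)]
      have := hexLabel_cases (2 * n) 1
      ext <;> dsimp only <;> omega
    have hodd : Odd (1 + 2 * (n : ℤ) * T) := ⟨n * T, by ring⟩
    obtain ⟨⟨a1, a2⟩, ⟨a3, a4⟩, a5, a6⟩ := hw
    obtain ⟨⟨b1, b2⟩, ⟨b3, b4⟩, b5, b6⟩ :=
      InHex.iterate_rot ⟨⟨a1, a2⟩, ⟨a3, a4⟩, a5, a6⟩ T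
    have near := ringHex_one_of_near (n := n) hodd
    rw [hone] at h
    simp only [hexPoint, Prod.mk.injEq] at h
    obtain ⟨e1, e2⟩ := h
    push_cast at e1 e2
    have hd := near
      (by
        have : |((ringHex (2 * n) (1 + 2 * n * T)).2 : ℝ)| ≤ 1 :=
          abs_le.2 ⟨by linarith, by linarith⟩
        exact_mod_cast this)
      (by
        have : |((ringHex (2 * n) (1 + 2 * n * T)).1 : ℝ) +
            (ringHex (2 * n) (1 + 2 * n * T)).2 + 2 * n| ≤ 1 :=
          abs_le.2 ⟨by linarith, by linarith⟩
        exact_mod_cast this)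
    rw [ringHex_congr hd, hone] at e1 e2
    push_cast at e1 e2
    have h6 : 6 ∣ T := six_dvd_of_rot_iterate hw0 (Prod.ext (by linarith) (by linarith))
    obtain ⟨s, rfl⟩ := h6
    obtain ⟨q, hq⟩ := hd
    -- The index condition is `6n + 1 ∣ 6ns`, and `6n` is `-1` modulo `6n + 1`.
    have hs : (6 * n + 1 : ℤ) ∣ s := ⟨s - q, by
      push_cast at hq
      have : 6 * (n : ℤ) * s = (6 * n + 1) * q := by linarith
      linear_combination -this⟩
    have : 6 * n + 1 ∣ s := by exact_mod_cast hs
    have := Nat.le_of_dvd (by omega) this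
    omega


/-! ### Non-perfect edges -/

/-- The offset `w` is that of a point of the open top edge of a hexagon. -/
def IsTop (w : ℝ × ℝ) : Prop := w.1 = 1 / 2 ∧ 0 < w.2 ∧ w.2 < 1 / 2

theorem IsTop.inHex {w : ℝ × ℝ} (hw : IsTop w) : InHex w := by
  obtain ⟨h1, h2, h3⟩ := hw
  refine ⟨⟨?_, ?_⟩, ⟨?_, ?_⟩, ?_, ?_⟩ <;> linarith

theorem IsTop.six_dvd {w : ℝ × ℝ} (hw : IsTop w) {t : ℕ} (h : (rot^[t] w).1 = 1 / 2) : 6 ∣ t := by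
  rw [rot_iterate_mod] at h
  obtain ⟨h1, h2, h3⟩ := hw
  have hlt := Nat.mod_lt t (show 6 > 0 by norm_num)
  refine Nat.dvd_of_mod_eq_zero ?_
  generalize t % 6 = r at *
  by_contra hr
  interval_cases r <;> simp [rot] at h hr <;> linarith

/-- An open edge borders only one hexagon: for a rotation other than the identity, the two centers
would differ by a non-integer in some lattice coordinate. For the half turn this shows only in the
second coordinate. -/
theorem hexPoint_eq_of_rot {c c' : ℤ × ℤ} {w : ℝ × ℝ} (hw : IsTop w) {t : ℕ}
    (h : hexPoint c (rot^[t] w) = hexPoint c' w) : 6 ∣ t ∧ c = c' := by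
  rw [rot_iterate_mod] at h
  obtain ⟨h1, h2, h3⟩ := hw
  obtain ⟨k, l⟩ := c
  obtain ⟨k', l'⟩ := c'
  obtain ⟨β, δ⟩ := w
  dsimp only at h1 h2 h3
  subst h1
  have hlt := Nat.mod_lt t (show 6 > 0 by norm_num)
  have main : t % 6 = 0 ∧ (k, l) = (k', l') := by
    generalize t % 6 = r at *
    simp only [hexPoint, Prod.mk.injEq] at h ⊢
    obtain ⟨e1, e2⟩ := h
    have no : ∀ a b : ℤ, (a : ℝ) < b → (b : ℝ) < a + 1 → False := by
      intro a b hab hba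
      have h4 : a < b := by exact_mod_cast hab
      have h5 : b < a + 1 := by exact_mod_cast hba
      omega
    interval_cases r <;> simp [rot] at e1 e2 ⊢
    · have h4 : l = l' := by exact_mod_cast e1
      have h5 : (k : ℝ) = k' := by rw [h4] at e2; linarith
      exact ⟨by exact_mod_cast h5, h4⟩
    · exact no l' l (by linarith) (by linarith)
    · exact no l' l (by linarith) (by linarith)
    · refine no (k' + l') (k + l) ?_ ?_ <;> push_cast <;> linarith
    · exact no l' l (by linarith) (by linarith)
    · exact no l' l (by linarith) (by linarith)
  exact ⟨Nat.dvd_of_mod_eq_zero main.1, main.2⟩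

/-- A point of the top edge of the left hexagon of a ring directly below the critical line. -/
noncomputable def leftExit (h : ℤ) (w : ℝ × ℝ) : ℝ × ℝ := hexPoint (-h, -1) w

/-- A point of the top edge of the right hexagon of a ring directly below the critical line. -/
noncomputable def rightExit (h : ℤ) (w : ℝ × ℝ) : ℝ × ℝ := hexPoint (h, -1) w

/-- A left exit leads outward, as if the point had been at index `0` of the next larger ring; a
right exit leads inward, as if from index `3h + 2` of the next smaller one. -/
theorem latticeMap_leftExit {h : ℤ} (hh : 0 ≤ h) {w : ℝ × ℝ} (hw : IsTop w) :
    latticeMap (leftExit (h - 1) w) = hexPoint (ringHex h (0 + h)) (rot w) := by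
  rw [leftExit, latticeMap_hexPoint_exit _ hw.1, ringHex_add hh, ringHex_zero hh]
  congr 1
  simp only [nextHex]
  ext <;> simp

theorem latticeMap_rightExit {h : ℤ} (hh : 0 ≤ h) {w : ℝ × ℝ} (hw : IsTop w) :
    latticeMap (rightExit (h + 1) w) = hexPoint (ringHex h (3 * h + 2 + h)) (rot w) := by
  rw [rightExit, latticeMap_hexPoint_exit _ hw.1, ringHex_add hh, ringHex_right hh]
  congr 1
  simp only [nextHex]
  ext <;> simp
  ring

/-- The orbit of `x` leads to `y` in `T` steps and does not meet `z` in between. -/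
def Leads (z x y : ℝ × ℝ) (T : ℕ) : Prop :=
  latticeMap^[T] x = y ∧ ∀ t, 0 < t → t < T → latticeMap^[t] x ≠ z

theorem Leads.trans {z x y u : ℝ × ℝ} {T S : ℕ} (h1 : Leads z x y T) (hy : y ≠ z)
    (h2 : Leads z y u S) : Leads z x u (S + T) := by
  refine ⟨by rw [Function.iterate_add_apply, h1.1, h2.1], fun t ht htT => ?_⟩
  obtain hlt | rfl | hgt := lt_trichotomy t T
  · exact h1.2 t ht hlt
  · rw [h1.1]; exact hy
  · obtain ⟨s, rfl⟩ := Nat.exists_eq_add_of_lt hgt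
    rw [show T + s + 1 = s + 1 + T by ring, Function.iterate_add_apply, h1.1]
    exact h2.2 _ (by omega) (by omega)

/-- Following a ring from one exit to the next. -/
theorem leads_hexPoint {h i : ℤ} (hh : 0 ≤ h) {w x : ℝ × ℝ} (hw : IsTop w)
    (hx : latticeMap x = hexPoint (ringHex h (i + h)) (rot w)) {T : ℕ} (hT : 0 < T)
    (H : ∀ s : ℕ, 0 < s → 6 * s < T →
      ¬ 6 * h + 2 ∣ i - 2 * s - (3 * h + 2) ∧ ¬ 6 * h + 2 ∣ i - 2 * s) (k : ℤ) :
    Leads (hexPoint (k, -1) w) x (hexPoint (ringHex h (i + h * T)) (rot^[T] w)) T := by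
  -- The offset is on the top edge only at times `6s`, when the index is `i - 2s` modulo `6h + 2`;
  -- so `H` excludes precisely the earlier exits.
  have noexit : ∀ t : ℕ, 0 < t → t < T → 6 ∣ t → (ringHex h (i + h * t)).2 ≠ -1 := by
    rintro _ ht hlt ⟨s, rfl⟩ hs
    have e : ∀ a : ℤ, 6 * h + 2 ∣ i + h * (6 * s : ℕ) - a → 6 * h + 2 ∣ i - 2 * s - a := by
      rintro a ⟨q, hq⟩
      exact ⟨q - s, by push_cast at hq; linear_combination hq⟩
    obtain hd | hd := snd_ringHex_eq_neg_one hh hs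
    · exact (H s (by omega) hlt).1 (e _ hd)
    · exact (H s (by omega) hlt).2 (by simpa using e 0 (by simpa using hd))
  have key : ∀ t, 0 < t → t ≤ T →
      latticeMap^[t] x = hexPoint (ringHex h (i + h * t)) (rot^[t] w) := by
    intro t ht hlt
    obtain ⟨t, rfl⟩ := Nat.exists_eq_add_of_lt ht
    rw [zero_add] at *
    rw [Function.iterate_succ_apply, hx, iterate_hexPoint hh hw.inHex.rot t,
      Function.iterate_succ_apply]
    · congr 2; push_cast; ring
    · intro s hs h1 h2
      rw [← Function.iterate_succ_apply] at h2
      refine noexit (s + 1) (by omega) (by omega) (hw.six_dvd h2) ?_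
      rw [← h1]
      congr 2; push_cast; ring
  refine ⟨key T hT le_rfl, fun t ht hlt h' => ?_⟩
  rw [key t ht hlt.le] at h'
  obtain ⟨h6, hc⟩ := hexPoint_eq_of_rot hw h'
  exact noexit t ht hlt h6 (by rw [hc])

theorem rot_iterate_of_dvd {t : ℕ} (h : 6 ∣ t) (w : ℝ × ℝ) : rot^[t] w = w := by
  rw [rot_iterate_mod, Nat.mod_eq_zero_of_dvd h]
  rfl

theorem not_dvd_of_lt {m a : ℤ} (h1 : 0 < a) (h2 : a < m) : ¬ m ∣ a :=
  fun h => absurd (Int.le_of_dvd h1 h) (not_le.2 h2)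

/-- On an odd ring the two exit indices have opposite parity while `i - 2s` keeps its parity, so the
orbit leaves at the side where it entered, once `2s = 6h + 2`. -/
theorem leads_leftExit_odd (n : ℕ) {w : ℝ × ℝ} (hw : IsTop w) {T : ℕ} (h0 : 0 < T)
    (hT : T ≤ 36 * n + 24) (k : ℤ) :
    Leads (hexPoint (k, -1) w) (leftExit (2 * n) w)
      (hexPoint (ringHex (2 * n + 1) (0 + (2 * n + 1) * T)) (rot^[T] w)) T := by
  have hx := latticeMap_leftExit (h := 2 * (n : ℤ) + 1) (by omega) hw
  rw [add_sub_cancel_right] at hx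
  refine leads_hexPoint (by omega) hw hx h0 (fun s hs hsT => ⟨?_, ?_⟩) k
  · rintro ⟨q, hq⟩
    have : (6 * (2 * (n : ℤ) + 1) + 2) * q = 2 * ((6 * n + 4) * q) := by ring
    omega
  · rw [zero_sub, Int.dvd_neg]
    exact not_dvd_of_lt (by omega) (by omega)

theorem leads_rightExit_odd (n : ℕ) {w : ℝ × ℝ} (hw : IsTop w) {T : ℕ} (h0 : 0 < T)
    (hT : T ≤ 36 * n + 24) (k : ℤ) :
    Leads (hexPoint (k, -1) w) (rightExit (2 * n + 2) w)
      (hexPoint (ringHex (2 * n + 1) (3 * (2 * n + 1) + 2 + (2 * n + 1) * T)) (rot^[T] w)) T := by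
  have hx := latticeMap_rightExit (h := 2 * (n : ℤ) + 1) (by omega) hw
  rw [show (2 * n + 1 + 1 : ℤ) = 2 * n + 2 by ring] at hx
  refine leads_hexPoint (by omega) hw hx h0 (fun s hs hsT => ⟨?_, ?_⟩) k
  · rw [sub_right_comm, sub_self, zero_sub, Int.dvd_neg]
    exact not_dvd_of_lt (by omega) (by omega)
  · rintro ⟨q, hq⟩
    have : (6 * (2 * (n : ℤ) + 1) + 2) * q = 2 * ((6 * n + 4) * q) := by ring
    omega

/-- On an even ring both exit indices are even and the orbit crosses over: from index `0` the right
exit comes first, at `2s = 3h`; from index `3h + 2` the left exit, at `2s = 3h + 2`. -/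
theorem leads_leftExit_even (n : ℕ) {w : ℝ × ℝ} (hw : IsTop w) {T : ℕ} (h0 : 0 < T)
    (hT : T ≤ 18 * n + 18) (k : ℤ) :
    Leads (hexPoint (k, -1) w) (leftExit (2 * n + 1) w)
      (hexPoint (ringHex (2 * n + 2) (0 + (2 * n + 2) * T)) (rot^[T] w)) T := by
  have hx := latticeMap_leftExit (h := 2 * (n : ℤ) + 2) (by omega) hw
  rw [show (2 * n + 2 - 1 : ℤ) = 2 * n + 1 by ring] at hx
  refine leads_hexPoint (by omega) hw hx h0 (fun s hs hsT => ⟨?_, ?_⟩) k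
  · rw [← Int.dvd_neg]
    exact not_dvd_of_lt (by omega) (by omega)
  · rw [zero_sub, Int.dvd_neg]
    exact not_dvd_of_lt (by omega) (by omega)

theorem leads_rightExit_even (n : ℕ) {w : ℝ × ℝ} (hw : IsTop w) {T : ℕ} (h0 : 0 < T)
    (hT : T ≤ 18 * n + 6) (k : ℤ) :
    Leads (hexPoint (k, -1) w) (rightExit (2 * n + 1) w)
      (hexPoint (ringHex (2 * n) (3 * (2 * n) + 2 + 2 * n * T)) (rot^[T] w)) T := by
  have hx := latticeMap_rightExit (h := 2 * (n : ℤ)) (by omega) hw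
  refine leads_hexPoint (by omega) hw hx h0 (fun s hs hsT => ⟨?_, ?_⟩) k
  · rw [sub_right_comm, sub_self, zero_sub, Int.dvd_neg]
    exact not_dvd_of_lt (by omega) (by omega)
  · exact not_dvd_of_lt (by omega) (by omega)

theorem leads_leftExit_leftExit (n : ℕ) {w : ℝ × ℝ} (hw : IsTop w) (k : ℤ) :
    Leads (hexPoint (k, -1) w) (leftExit (2 * n) w) (leftExit (2 * n + 1) w) (36 * n + 24) := by
  have := leads_leftExit_odd n hw (by omega) le_rfl k
  rwa [rot_iterate_of_dvd (by omega), ringHex_congr (j := 0) ⟨3 * (2 * n + 1), by push_cast; ring⟩,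
    ringHex_zero (by omega)] at this

theorem leads_leftExit_rightExit (n : ℕ) {w : ℝ × ℝ} (hw : IsTop w) (k : ℤ) :
    Leads (hexPoint (k, -1) w) (leftExit (2 * n + 1) w) (rightExit (2 * n + 2) w)
      (18 * n + 18) := by
  have := leads_leftExit_even n hw (by omega) le_rfl k
  rwa [rot_iterate_of_dvd (by omega), ringHex_congr (j := 3 * (2 * n + 2) + 2)
    ⟨3 * n + 2, by push_cast; ring⟩, ringHex_right (by omega)] at this

theorem leads_rightExit_rightExit (n : ℕ) {w : ℝ × ℝ} (hw : IsTop w) (k : ℤ) :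
    Leads (hexPoint (k, -1) w) (rightExit (2 * n + 2) w) (rightExit (2 * n + 1) w)
      (36 * n + 24) := by
  have := leads_rightExit_odd n hw (by omega) le_rfl k
  rwa [rot_iterate_of_dvd (by omega), ringHex_congr (j := 3 * (2 * n + 1) + 2)
    ⟨3 * (2 * n + 1), by push_cast; ring⟩, ringHex_right (by omega)] at this

theorem leads_rightExit_leftExit (n : ℕ) {w : ℝ × ℝ} (hw : IsTop w) (k : ℤ) :
    Leads (hexPoint (k, -1) w) (rightExit (2 * n + 1) w) (leftExit (2 * n) w) (18 * n + 6) := by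
  have := leads_rightExit_even n hw (by omega) le_rfl k
  rwa [rot_iterate_of_dvd (by omega), ringHex_congr (j := 0)
    ⟨3 * n + 1, by push_cast; ring⟩, ringHex_zero (by omega)] at this

theorem minimalPeriod_leftExit (n : ℕ) {w : ℝ × ℝ} (hw : IsTop w) :
    Function.minimalPeriod latticeMap (leftExit (2 * n) w) = 108 * n + 72 := by
  have hne : ∀ a b : ℤ, a ≠ b → hexPoint (a, -1) w ≠ hexPoint (b, -1) w := by
    intro a b hab h
    have := (hexPoint_eq_of_rot (t := 0) hw h).2
    simp only [Prod.mk.injEq] at this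
    exact hab this.1
  obtain ⟨h1, h2⟩ := (((leads_leftExit_leftExit n hw (-(2 * n))).trans (hne _ _ (by omega))
    (leads_leftExit_rightExit n hw _)).trans (hne _ _ (by omega))
    (leads_rightExit_rightExit n hw _)).trans (hne _ _ (by omega))
    (leads_rightExit_leftExit n hw _)
  rw [show 18 * n + 6 + (36 * n + 24 + (18 * n + 18 + (36 * n + 24))) = 108 * n + 72 by ring]
    at h1 h2
  exact minimalPeriod_eq_of_forall (by omega) h1 h2

theorem minimalPeriod_leftExit_succ (n : ℕ) {w : ℝ × ℝ} (hw : IsTop w) :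
    Function.minimalPeriod latticeMap (leftExit (2 * n + 1) w) = 108 * n + 72 := by
  rw [← (leads_leftExit_leftExit n hw 0).1,
    minimalPeriod_iterate_of_injective latticeMap_injective, minimalPeriod_leftExit n hw]

theorem minimalPeriod_rightExit_add_two (n : ℕ) {w : ℝ × ℝ} (hw : IsTop w) :
    Function.minimalPeriod latticeMap (rightExit (2 * n + 2) w) = 108 * n + 72 := by
  rw [← (leads_leftExit_rightExit n hw 0).1,
    minimalPeriod_iterate_of_injective latticeMap_injective, minimalPeriod_leftExit_succ n hw]

theorem minimalPeriod_rightExit_succ (n : ℕ) {w : ℝ × ℝ} (hw : IsTop w) :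
    Function.minimalPeriod latticeMap (rightExit (2 * n + 1) w) = 108 * n + 72 := by
  rw [← (leads_rightExit_rightExit n hw 0).1,
    minimalPeriod_iterate_of_injective latticeMap_injective, minimalPeriod_rightExit_add_two n hw]

/-! ### Placing edge points on the cycle of exits. -/

theorem exists_nat_congr {N : ℕ} (hN : 0 < N) (a : ℤ) :
    ∃ T : ℕ, 0 < T ∧ T ≤ N ∧ ∃ q : ℤ, (T : ℤ) = a + N * q := by
  have h1 := Int.emod_nonneg (a - 1) (show (N : ℤ) ≠ 0 by omega)
  have h2 := Int.emod_lt_of_pos (a - 1) (show 0 < (N : ℤ) by omega)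
  refine ⟨((a - 1) % N + 1).toNat, by omega, by omega, -((a - 1) / N), ?_⟩
  rw [Int.toNat_of_nonneg (by omega)]
  linear_combination Int.emod_add_mul_ediv (a - 1) N

theorem minimalPeriod_edge_odd (n : ℕ) (i : ℤ) (j : ℕ) {w : ℝ × ℝ} (hw : IsTop w) :
    Function.minimalPeriod latticeMap (hexPoint (ringHex (2 * n + 1) i) (rot^[j] w)) =
      108 * n + 72 := by
  have key : ∀ i e : ℤ, i - j = 2 * e → ∃ T : ℕ, 0 < T ∧ T ≤ 36 * n + 24 ∧ T % 6 = j % 6 ∧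
      6 * (2 * (n : ℤ) + 1) + 2 ∣ (2 * n + 1) * T - i := by
    intro i e he
    -- This `T` solves `T ≡ j` modulo `6` and `(2n + 1) T ≡ i` modulo `12n + 8`, where `6n + 1` is
    -- the inverse of `2n + 1`. Both moduli are even, so `i - j` must be even; for odd `i - j` the
    -- right exit, of odd index, serves as start.
    obtain ⟨T, h1, h2, q, hq⟩ := exists_nat_congr (show 0 < 36 * n + 24 by omega)
      ((6 * n + 1) * i - (12 * n + 8) * e)
    refine ⟨T, h1, h2, ?_, n * i - (2 * n + 1) * e + 3 * (2 * n + 1) * q, ?_⟩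
    · have : (T : ℤ) = j + 6 * (n * i - 2 * n * e - e + (6 * n + 4) * q) := by
        rw [hq]; push_cast; linear_combination he
      omega
    · rw [hq]; push_cast; ring
  obtain ⟨e, he⟩ | ⟨e, he⟩ := Int.even_or_odd (i - j)
  · obtain ⟨T, h1, h2, h3, h4⟩ := key i e (by omega)
    rw [rot_iterate_mod j, ← h3, ← rot_iterate_mod,
      ← ringHex_congr (i := 0 + (2 * n + 1) * T) (by rwa [zero_add]),
      ← (leads_leftExit_odd n hw h1 h2 0).1,
      minimalPeriod_iterate_of_injective latticeMap_injective, minimalPeriod_leftExit n hw]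
  · obtain ⟨T, h1, h2, h3, h4⟩ := key (i - (3 * (2 * n + 1) + 2)) (e - 3 * n - 2) (by omega)
    rw [rot_iterate_mod j, ← h3, ← rot_iterate_mod,
      ← ringHex_congr (i := 3 * (2 * n + 1) + 2 + (2 * n + 1) * T) (by convert h4 using 1; ring),
      ← (leads_rightExit_odd n hw h1 h2 0).1,
      minimalPeriod_iterate_of_injective latticeMap_injective,
      minimalPeriod_rightExit_add_two n hw]

theorem minimalPeriod_edge_even (n : ℕ) {i : ℤ} (hi : Even i) (j : ℕ) {w : ℝ × ℝ}
    (hw : IsTop w) :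
    ∃ m : ℕ, Function.minimalPeriod latticeMap (hexPoint (ringHex (2 * n) i) (rot^[j] w)) =
      108 * m + 72 := by
  obtain ⟨p, rfl⟩ := hi
  -- Chinese remainders: `T ≡ j` modulo `6`, and `T ≡ -6p` modulo `6n + 1`, where `-6` is the
  -- inverse of `n`.
  obtain ⟨T, h1, h2, q, hq⟩ := exists_nat_congr (show 0 < 36 * n + 6 by omega)
    (-6 * p + (6 * n + 1) * j)
  have h3 : T % 6 = j % 6 := by
    have : (T : ℤ) = j + 6 * (-p + n * j + (6 * n + 1) * q) := by
      rw [hq]; push_cast; ring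
    omega
  have h4 : 2 * (n : ℤ) * T - (p + p) = (6 * (2 * n) + 2) * (-p + n * j + 6 * n * q) := by
    rw [hq]; push_cast; ring
  -- Moving by `2n` from index `0`, the index is `3h + 2` after `18n` steps, where the left stretch
  -- ends; later times are counted from the right exit.
  by_cases hT : T ≤ 18 * n
  · obtain ⟨m, rfl⟩ : ∃ m, n = m + 1 := ⟨n - 1, by omega⟩
    refine ⟨m, ?_⟩
    rw [rot_iterate_mod j, ← h3, ← rot_iterate_mod,
      ← ringHex_congr (i := 0 + 2 * (m + 1 : ℕ) * T) ⟨_, by rw [← h4]; ring⟩]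
    have := (leads_leftExit_even m hw h1 (by omega) 0).1
    rw [show (2 * m + 2 : ℤ) = 2 * (m + 1 : ℕ) by push_cast; ring] at this
    rw [← this, minimalPeriod_iterate_of_injective latticeMap_injective,
      minimalPeriod_leftExit_succ m hw]
  · refine ⟨n, ?_⟩
    obtain ⟨S, rfl⟩ : ∃ S, T = S + 18 * n := ⟨T - 18 * n, by omega⟩
    rw [rot_iterate_mod j, ← h3, show (S + 18 * n) % 6 = S % 6 by omega, ← rot_iterate_mod,
      ← ringHex_congr (i := 3 * (2 * n) + 2 + 2 * n * S)
        ⟨-p + n * j + 6 * n * q - (3 * n - 1), by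
          push_cast at h4
          linear_combination h4⟩,
      ← (leads_rightExit_even n hw (by omega) (by omega) 0).1,
      minimalPeriod_iterate_of_injective latticeMap_injective, minimalPeriod_rightExit_succ n hw]

/-- The six open edges are the rotated copies of the top one; being off the crossings makes the
other two offset inequalities strict. -/
theorem exists_isTop_of_openEdge {c : ℤ × ℤ} {w : ℝ × ℝ} (hw : InHex w)
    (hv : ¬ IsCrossing (hexPoint c w))
    (he : (|w.1| = 1 / 2 ∨ |w.2| = 1 / 2) ∨ |w.1 - w.2| = 1 / 2) :
    ∃ (j : ℕ) (u : ℝ × ℝ), IsTop u ∧ rot^[j] u = w := by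
  obtain ⟨⟨h1, h2⟩, ⟨h3, h4⟩, h5, h6⟩ := hw
  obtain ⟨k, l⟩ := c
  obtain ⟨β, δ⟩ := w
  have i1 : |β| = 1 / 2 → ∃ a : ℤ, l + 1 / 2 + β = a := by
    intro h
    obtain h | h := (abs_eq (by norm_num)).1 h
    · exact ⟨l + 1, by rw [h]; push_cast; ring⟩
    · exact ⟨l, by rw [h]; ring⟩
  have i2 : |δ| = 1 / 2 → ∃ a : ℤ, k + l + 1 / 2 + δ = a := by
    intro h
    obtain h | h := (abs_eq (by norm_num)).1 h
    · exact ⟨k + l + 1, by rw [h]; push_cast; ring⟩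
    · exact ⟨k + l, by rw [h]; push_cast; ring⟩
  have i3 : |β - δ| = 1 / 2 →
      ∃ a : ℤ, (k + l + 1 / 2 + δ) - (l + 1 / 2 + β) = a + 1 / 2 := by
    intro h
    obtain h | h := (abs_eq (by norm_num)).1 h
    · exact ⟨k - 1, by push_cast; linarith⟩
    · exact ⟨k, by linarith⟩
  have n12 : |β| = 1 / 2 → |δ| ≠ 1 / 2 := fun a b => hv <| by
    obtain ⟨_, a⟩ := i1 a
    obtain ⟨_, b⟩ := i2 b
    exact .inl ⟨_, _, a, b⟩
  have n13 : |β| = 1 / 2 → |β - δ| ≠ 1 / 2 := fun a b => hv <| by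
    obtain ⟨_, a⟩ := i1 a
    obtain ⟨_, b⟩ := i3 b
    exact .inr (.inl ⟨_, _, a, b⟩)
  have n23 : |δ| = 1 / 2 → |β - δ| ≠ 1 / 2 := fun a b => hv <| by
    obtain ⟨_, a⟩ := i2 a
    obtain ⟨_, b⟩ := i3 b
    exact .inr (.inr ⟨_, _, a, b⟩)
  dsimp only at he h1 h2 h3 h4 h5 h6
  have lt : ∀ x : ℝ, -(1 / 2) ≤ x → x ≤ 1 / 2 → |x| ≠ 1 / 2 → -(1 / 2) < x ∧ x < 1 / 2 := by
    intro x a b hx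
    exact abs_lt.1 (lt_of_le_of_ne (abs_le.2 ⟨a, b⟩) hx)
  obtain (he | he) | he := he
  · obtain ⟨a1, a2⟩ := lt _ h3 h4 (n12 he)
    obtain ⟨a3, a4⟩ := lt _ h5 h6 (n13 he)
    obtain h | h := (abs_eq (by norm_num)).1 he
    · exact ⟨0, (β, δ), ⟨h, by linarith, a2⟩, rfl⟩
    · exact ⟨3, (-β, -δ), ⟨by dsimp only; linarith, by dsimp only; linarith,
        by dsimp only; linarith⟩, by ext <;> simp [rot]⟩
  · obtain ⟨a1, a2⟩ := lt _ h1 h2 fun h => n12 h he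
    obtain ⟨a3, a4⟩ := lt _ h5 h6 (n23 he)
    obtain h | h := (abs_eq (by norm_num)).1 he
    · exact ⟨1, (δ, δ - β), ⟨h, by dsimp only; linarith, by dsimp only; linarith⟩,
        by ext <;> simp [rot]⟩
    · exact ⟨4, (-δ, -(δ - β)), ⟨by dsimp only; linarith, by dsimp only; linarith,
        by dsimp only; linarith⟩, by ext <;> simp [rot]⟩
  · obtain ⟨a1, a2⟩ := lt _ h1 h2 fun h => n13 h he
    obtain ⟨a3, a4⟩ := lt _ h3 h4 fun h => n23 h he
    obtain h | h := (abs_eq (by norm_num)).1 he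
    · exact ⟨5, (β - δ, β), ⟨h, by dsimp only; linarith, by dsimp only; linarith⟩,
        by ext <;> simp [rot]⟩
    · exact ⟨2, (-(β - δ), -β), ⟨by dsimp only; linarith, by dsimp only; linarith,
        by dsimp only; linarith⟩, by ext <;> simp [rot]⟩


/-! ### Non-perfect vertices -/

/-- The point `v = c.2`, `d = c.1` with integer lattice coordinates. -/
def intPoint (c : ℤ × ℤ) : ℝ × ℝ := (c.2, c.1)

/-- The third iterate of the map on the points with integer lattice coordinates. -/
def vertexMap (c : ℤ × ℤ) : ℤ × ℤ :=
  if 0 ≤ c.2 then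
    if 0 ≤ c.2 - c.1 then
      if 0 ≤ -c.1 + 1 then (-c.1 + 1, -c.2 + 1) else (-c.1 + 1, -c.2)
    else
      if 0 ≤ -c.1 then (-c.1, -c.2) else (-c.1, -c.2 - 1)
  else
    if 1 ≤ c.2 - c.1 then
      if 0 ≤ -c.1 then (-c.1, -c.2 + 1) else (-c.1, -c.2)
    else
      if 0 ≤ -c.1 - 1 then (-c.1 - 1, -c.2) else (-c.1 - 1, -c.2 - 1)

theorem sgn_intCast_add (a : ℤ) {x : ℝ} (h0 : 0 ≤ x) (h1 : x < 1) :
    sgn (a + x) = if 0 ≤ a then 1 else -1 := by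
  unfold sgn
  split_ifs with h h' h'
  · rfl
  · have : a + 1 ≤ 0 := by omega
    have : (a : ℝ) + 1 ≤ 0 := by exact_mod_cast this
    linarith
  · have : (0 : ℝ) ≤ a := by exact_mod_cast h'
    linarith
  · rfl

theorem latticeMap_iterate_intPoint (c : ℤ × ℤ) :
    latticeMap^[3] (intPoint c) = intPoint (vertexMap c) := by
  obtain ⟨a, b⟩ := c
  have s1 : ∀ m : ℤ, sgn (m + 1 / 2) = if 0 ≤ m then 1 else -1 := fun m =>
    sgn_intCast_add m (by norm_num) (by norm_num)
  have s0 : ∀ m : ℤ, sgn m = if 0 ≤ m then 1 else -1 := fun m => by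
    have := sgn_intCast_add m le_rfl (by norm_num)
    rwa [add_zero] at this
  have step : ∀ (v d : ℝ), latticeMap (v, d) = (v - d + sgn v / 2, v) := fun _ _ => rfl
  have main : ∀ (m : ℤ) (x : ℤ), (b : ℝ) - a + sgn b / 2 = m + 1 / 2 →
      (m + 1 / 2 : ℝ) - b + sgn (m + 1 / 2 : ℝ) / 2 = x →
      latticeMap^[3] (intPoint (a, b)) = (x - (m + 1 / 2) + sgn x / 2, (x : ℝ)) := by
    intro m x h1 h2
    simp only [intPoint, Function.iterate_succ_apply, Function.iterate_zero, id, step]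
    rw [h1, h2]
  unfold vertexMap
  split_ifs with g0 g1 g2 g2 g1 g2 g2 <;> dsimp only at g0 g1 g2
  · rw [main (b - a) (-a + 1), s0, if_pos g2]
    · exact Prod.ext (by simp only [intPoint]; push_cast; ring) (by simp only [intPoint])
    · rw [s0, if_pos g0]; push_cast; ring
    · rw [s1, if_pos g1]; push_cast; ring
  · rw [main (b - a) (-a + 1), s0, if_neg g2]
    · exact Prod.ext (by simp only [intPoint]; push_cast; ring) (by simp only [intPoint])
    · rw [s0, if_pos g0]; push_cast; ring
    · rw [s1, if_pos g1]; push_cast; ring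
  · rw [main (b - a) (-a), s0, if_pos g2]
    · exact Prod.ext (by simp only [intPoint]; push_cast; ring) (by simp only [intPoint])
    · rw [s0, if_pos g0]; push_cast; ring
    · rw [s1, if_neg g1]; push_cast; ring
  · rw [main (b - a) (-a), s0, if_neg g2]
    · exact Prod.ext (by simp only [intPoint]; push_cast; ring) (by simp only [intPoint])
    · rw [s0, if_pos g0]; push_cast; ring
    · rw [s1, if_neg g1]; push_cast; ring
  · rw [main (b - a - 1) (-a), s0, if_pos g2]
    · exact Prod.ext (by simp only [intPoint]; push_cast; ring) (by simp only [intPoint])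
    · rw [s0, if_neg g0]; push_cast; ring
    · rw [s1, if_pos (by omega)]; push_cast; ring
  · rw [main (b - a - 1) (-a), s0, if_neg g2]
    · exact Prod.ext (by simp only [intPoint]; push_cast; ring) (by simp only [intPoint])
    · rw [s0, if_neg g0]; push_cast; ring
    · rw [s1, if_pos (by omega)]; push_cast; ring
  · rw [main (b - a - 1) (-a - 1), s0, if_pos g2]
    · exact Prod.ext (by simp only [intPoint]; push_cast; ring) (by simp only [intPoint])
    · rw [s0, if_neg g0]; push_cast; ring
    · rw [s1, if_neg (by omega)]; push_cast; ring
  · rw [main (b - a - 1) (-a - 1), s0, if_neg g2]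
    · exact Prod.ext (by simp only [intPoint]; push_cast; ring) (by simp only [intPoint])
    · rw [s0, if_neg g0]; push_cast; ring
    · rw [s1, if_neg (by omega)]; push_cast; ring

theorem latticeMap_iterate_three_mul (t : ℕ) (c : ℤ × ℤ) :
    latticeMap^[3 * t] (intPoint c) = intPoint (vertexMap^[t] c) := by
  induction t with
  | zero => rfl
  | succ t ih =>
    rw [mul_add, mul_one, add_comm, Function.iterate_add_apply, ih, latticeMap_iterate_intPoint,
      Function.iterate_succ_apply']

theorem intPoint_injective : Function.Injective intPoint := by
  rintro ⟨a, b⟩ ⟨a', b'⟩ h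
  simp only [intPoint, Prod.mk.injEq, Int.cast_inj] at h
  rw [h.1, h.2]

theorem intCast_ne_add_half {a b : ℤ} (h : (a : ℝ) = b + 1 / 2) : False := by
  have : (2 * a : ℝ) = 2 * b + 1 := by linarith
  have : 2 * a = 2 * b + 1 := by exact_mod_cast this
  omega

theorem latticeMap_intPoint (c : ℤ × ℤ) :
    ∃ m : ℤ, latticeMap (intPoint c) = ((m : ℝ) + 1 / 2, (c.2 : ℝ)) := by
  by_cases h : (0 : ℝ) ≤ c.2
  · refine ⟨c.2 - c.1, ?_⟩
    have : sgn c.2 = 1 := if_pos h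
    simp only [latticeMap, intPoint, this]; push_cast; congr 1
  · refine ⟨c.2 - c.1 - 1, ?_⟩
    have : sgn c.2 = -1 := if_neg h
    simp only [latticeMap, intPoint, this]; push_cast; congr 1; ring

/-- One or two steps after an integer point some coordinate is a half-integer. -/
theorem three_dvd_of_isPeriodicPt {c : ℤ × ℤ} {T : ℕ}
    (h : Function.IsPeriodicPt latticeMap T (intPoint c)) : 3 ∣ T := by
  unfold Function.IsPeriodicPt Function.IsFixedPt at h
  have hlt := Nat.mod_lt T (show 3 > 0 by norm_num)
  refine Nat.dvd_of_mod_eq_zero ?_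
  rw [← Nat.mod_add_div T 3, Function.iterate_add_apply, latticeMap_iterate_three_mul] at h
  obtain ⟨m, hm⟩ := latticeMap_intPoint (vertexMap^[T / 3] c)
  generalize T % 3 = r at *
  by_contra hr
  interval_cases r
  · exact hr rfl
  · rw [Function.iterate_one, hm] at h
    exact intCast_ne_add_half (congrArg Prod.fst h).symm
  · rw [Function.iterate_succ_apply, Function.iterate_one, hm] at h
    exact intCast_ne_add_half (congrArg Prod.snd h).symm

/-- The `j`-th point of the closed walk along the non-perfect vertices with integer coordinates
at distance `2n + 1 + e` from the origin, where `e ∈ {0, 1}`. -/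
def vertexWalk (e n j : ℤ) : ℤ × ℤ :=
  if j ≤ n then (2 * j - (2 * n + 1 + e), -(2 * n + 1 + e))
  else if j ≤ 2 * n + 1 + e then (2 * j - (2 * n + 1 + e), 2 * j - (4 * n + 2 + e))
  else if j ≤ 3 * n + 1 + e then (2 * n + 1 + e, 2 * j - (4 * n + 2 + e))
  else if j ≤ 4 * n + 2 + e then (8 * n + 4 + 3 * e - 2 * j, 2 * n + 1 + e)
  else if j ≤ 5 * n + 2 + 2 * e then (8 * n + 4 + 3 * e - 2 * j, 10 * n + 5 + 3 * e - 2 * j)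
  else (-(2 * n + 1 + e), 10 * n + 5 + 3 * e - 2 * j)

theorem vertexWalk_cases (e n j : ℤ) :
    (j ≤ n ∧ (vertexWalk e n j).1 = 2 * j - (2 * n + 1 + e) ∧
      (vertexWalk e n j).2 = -(2 * n + 1 + e)) ∨
    (n < j ∧ j ≤ 2 * n + 1 + e ∧ (vertexWalk e n j).1 = 2 * j - (2 * n + 1 + e) ∧
      (vertexWalk e n j).2 = 2 * j - (4 * n + 2 + e)) ∨
    (n < j ∧ 2 * n + 1 + e < j ∧ j ≤ 3 * n + 1 + e ∧ (vertexWalk e n j).1 = 2 * n + 1 + e ∧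
      (vertexWalk e n j).2 = 2 * j - (4 * n + 2 + e)) ∨
    (n < j ∧ 2 * n + 1 + e < j ∧ 3 * n + 1 + e < j ∧ j ≤ 4 * n + 2 + e ∧
      (vertexWalk e n j).1 = 8 * n + 4 + 3 * e - 2 * j ∧
      (vertexWalk e n j).2 = 2 * n + 1 + e) ∨
    (n < j ∧ 2 * n + 1 + e < j ∧ 3 * n + 1 + e < j ∧ 4 * n + 2 + e < j ∧ j ≤ 5 * n + 2 + 2 * e ∧
      (vertexWalk e n j).1 = 8 * n + 4 + 3 * e - 2 * j ∧
      (vertexWalk e n j).2 = 10 * n + 5 + 3 * e - 2 * j) ∨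
    (n < j ∧ 2 * n + 1 + e < j ∧ 3 * n + 1 + e < j ∧ 4 * n + 2 + e < j ∧ 5 * n + 2 + 2 * e < j ∧
      (vertexWalk e n j).1 = -(2 * n + 1 + e) ∧
      (vertexWalk e n j).2 = 10 * n + 5 + 3 * e - 2 * j) := by
  unfold vertexWalk
  split_ifs <;> simp_all

/-- With `N = 6n + 3 + 2e` the shift satisfies `2 (3n + 2 + e) = N + 1`: it is the inverse of `2`
modulo `N`, so `vertexMap` runs through the whole walk in one cycle. -/
theorem vertexMap_vertexWalk {e n j : ℤ} (he : e = 0 ∨ e = 1) (hn : 0 ≤ n) (h0 : 0 ≤ j)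
    (h1 : j < 6 * n + 3 + 2 * e) :
    vertexMap (vertexWalk e n j) =
      vertexWalk e n ((j + (3 * n + 2 + e)) % (6 * n + 3 + 2 * e)) := by
  have key : ∀ m, 0 ≤ m → m < 6 * n + 3 + 2 * e →
      (m = j + (3 * n + 2 + e) ∨ m = j - (3 * n + 1 + e)) →
      vertexMap (vertexWalk e n j) = vertexWalk e n m := by
    intro m m0 m1 m2
    have e1 := vertexWalk_cases e n j
    have e2 := vertexWalk_cases e n m
    generalize vertexWalk e n j = c at *
    generalize vertexWalk e n m = c' at *
    obtain ⟨k, l⟩ := c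
    obtain ⟨k', l'⟩ := c'
    dsimp only [vertexMap] at *
    rcases he with rfl | rfl <;> rcases m2 with rfl | rfl <;>
    rcases e1 with e1 | e1 | e1 | e1 | e1 | e1 <;> obtain ⟨e1, e3⟩ := e1 <;>
    rcases e2 with e2 | e2 | e2 | e2 | e2 | e2 <;> obtain ⟨e2, e4⟩ := e2 <;>
    first
    | (exfalso; omega)
    | (split_ifs <;> simp only [Prod.mk.injEq] <;> omega)
  by_cases h : j + (3 * n + 2 + e) < 6 * n + 3 + 2 * e
  · rw [Int.emod_eq_of_lt (by omega) h]
    exact key _ (by omega) h (.inl rfl)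
  · rw [← Int.sub_emod_right, Int.emod_eq_of_lt (by omega) (by omega)]
    exact key _ (by omega) (by omega) (.inr (by ring))

theorem vertexMap_iterate_vertexWalk {e n : ℤ} (he : e = 0 ∨ e = 1) (hn : 0 ≤ n) (t : ℕ) :
    vertexMap^[t] (vertexWalk e n 0) =
      vertexWalk e n ((3 * n + 2 + e) * t % (6 * n + 3 + 2 * e)) := by
  induction t with
  | zero => simp
  | succ t ih =>
    rw [Function.iterate_succ_apply', ih, vertexMap_vertexWalk he hn (Int.emod_nonneg _ (by omega))
      (Int.emod_lt_of_pos _ (by omega)), Int.emod_add_emod]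
    congr 2; push_cast; ring

theorem minimalPeriod_vertexWalk {e n j : ℕ} (he : e = 0 ∨ e = 1) (hj : j < 6 * n + 3 + 2 * e) :
    Function.minimalPeriod latticeMap (intPoint (vertexWalk e n j)) =
      3 * (6 * n + 3 + 2 * e) := by
  have he' : (e : ℤ) = 0 ∨ (e : ℤ) = 1 := by exact_mod_cast he
  have hn : (0 : ℤ) ≤ n := by omega
  -- Two applications of `vertexMap` advance the walk by one place.
  have hjt : vertexWalk e n j = vertexMap^[2 * j] (vertexWalk e n 0) := by
    rw [vertexMap_iterate_vertexWalk he' hn,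
      show (3 * (n : ℤ) + 2 + e) * (2 * j : ℕ) = j + (6 * n + 3 + 2 * e) * j by push_cast; ring,
      Int.add_mul_emod_self_left, Int.emod_eq_of_lt (by omega) (by omega)]
  rw [hjt, ← latticeMap_iterate_three_mul, minimalPeriod_iterate_of_injective latticeMap_injective]
  refine minimalPeriod_eq_of_forall (by omega) ?_ ?_
  · unfold Function.IsPeriodicPt Function.IsFixedPt
    rw [latticeMap_iterate_three_mul, vertexMap_iterate_vertexWalk he' hn]
    push_cast
    rw [Int.mul_emod_left]
  · intro T h0 hT h
    obtain ⟨t, rfl⟩ := three_dvd_of_isPeriodicPt h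
    unfold Function.IsPeriodicPt Function.IsFixedPt at h
    rw [latticeMap_iterate_three_mul, vertexMap_iterate_vertexWalk he' hn] at h
    have h := intPoint_injective h
    have m0 := Int.emod_nonneg ((3 * (n : ℤ) + 2 + e) * t)
      (show 6 * (n : ℤ) + 3 + 2 * e ≠ 0 by omega)
    have m1 := Int.emod_lt_of_pos ((3 * (n : ℤ) + 2 + e) * t)
      (show 0 < 6 * (n : ℤ) + 3 + 2 * e by omega)
    have hz : (3 * (n : ℤ) + 2 + e) * t % (6 * (n : ℤ) + 3 + 2 * e) = 0 := by
      generalize (3 * (n : ℤ) + 2 + e) * t % (6 * (n : ℤ) + 3 + 2 * e) = m at *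
      have e1 := vertexWalk_cases e n m
      have e2 := vertexWalk_cases e n 0
      rw [h] at e1
      generalize vertexWalk e n 0 = c at *
      omega
    obtain ⟨q, hq⟩ := Int.dvd_of_emod_eq_zero hz
    have : 6 * (n : ℤ) + 3 + 2 * e ∣ t := ⟨2 * q - t, by linear_combination 2 * hq⟩
    have : 6 * n + 3 + 2 * e ∣ t := by exact_mod_cast this
    have := Nat.le_of_dvd (by omega) this
    omega

/-- The point with lattice coordinates `q` belongs to a perfect hexagon. -/
def InPerfect (q : ℝ × ℝ) : Prop :=
  ∃ (n : ℕ) (i : ℤ) (w : ℝ × ℝ), Odd i ∧ InHex w ∧ q = hexPoint (ringHex (2 * n) i) w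

theorem inPerfect_of_hexLabel {k l : ℤ} {w : ℝ × ℝ} (hw : InHex w)
    (H : ∀ h i, 0 ≤ h → 1 ≤ i → i ≤ 6 * h + 2 → hexLabel h i = (k, l) → h % 2 = 0 ∧ i % 2 = 1) :
    InPerfect (hexPoint (k, l) w) := by
  obtain ⟨h, i, h0, h1, h2, h3⟩ := exists_hexLabel k l
  obtain ⟨e1, e2⟩ := H h i h0 h1 h2 h3
  lift h to ℕ using h0
  obtain ⟨n, rfl⟩ : ∃ n, h = 2 * n := ⟨h / 2, by omega⟩
  refine ⟨n, i, w, Int.odd_iff.2 e2, hw, ?_⟩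
  push_cast at *
  rw [ringHex_eq_hexLabel h1 h2, h3]

/-- Parity of `a - b` decides: if `a` and `b` are both negative, even means on a walk and odd means
perfect; otherwise the roles are exchanged. In the perfect case, the two hexagons meeting at the
point are `(a - b, b)` and `(a - b, b - 1)`, and a parity condition selects the perfect one. -/
theorem exists_vertexWalk_or_inPerfect (c : ℤ × ℤ) :
    (∃ e n j : ℕ, (e = 0 ∨ e = 1) ∧ j < 6 * n + 3 + 2 * e ∧ c = vertexWalk e n j) ∨
      InPerfect (intPoint c) := by
  obtain ⟨a, b⟩ := c
  have aux : ∀ e n j : ℤ, (e = 0 ∨ e = 1) ∧ 0 ≤ n ∧ 0 ≤ j ∧ j < 6 * n + 3 + 2 * e ∧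
      a = (vertexWalk e n j).1 ∧ b = (vertexWalk e n j).2 →
      ∃ e n j : ℕ, (e = 0 ∨ e = 1) ∧ j < 6 * n + 3 + 2 * e ∧ (a, b) = vertexWalk e n j := by
    rintro e n j ⟨h1, h2, h3, h4, h5, h6⟩
    refine ⟨e.toNat, n.toNat, j.toNat, by omega, by omega, ?_⟩
    rw [Int.toNat_of_nonneg (by omega), Int.toNat_of_nonneg h2, Int.toNat_of_nonneg h3]
    exact Prod.ext h5 h6
  have perf : ∀ l, (l = b ∨ l = b - 1) → (∀ h i, 0 ≤ h → 1 ≤ i → i ≤ 6 * h + 2 →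
      hexLabel h i = (a - b, l) → h % 2 = 0 ∧ i % 2 = 1) → InPerfect (intPoint (a, b)) := by
    rintro l (rfl | rfl) H
    · have := inPerfect_of_hexLabel (w := (-(1 / 2), -(1 / 2)))
        (by refine ⟨⟨?_, ?_⟩, ⟨?_, ?_⟩, ?_, ?_⟩ <;> norm_num) H
      convert this using 1
      simp only [intPoint, hexPoint, Prod.mk.injEq]; push_cast; constructor <;> ring
    · have := inPerfect_of_hexLabel (w := (1 / 2, 1 / 2))
        (by refine ⟨⟨?_, ?_⟩, ⟨?_, ?_⟩, ?_, ?_⟩ <;> norm_num) H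
      convert this using 1
      simp only [intPoint, hexPoint, Prod.mk.injEq]; push_cast; constructor <;> ring
  by_cases hneg : a < 0 ∧ b < 0
  · obtain ⟨ha, hb⟩ := hneg
    by_cases hp : (a - b) % 2 = 0
    · left
      by_cases hab : b ≤ a
      · refine aux ((b + 1) % 2) ((-b - 1) / 2) ((a - b) / 2) ?_
        have := vertexWalk_cases ((b + 1) % 2) ((-b - 1) / 2) ((a - b) / 2)
        omega
      · refine aux ((a + 1) % 2) ((-a - 1) / 2)
          ((10 * ((-a - 1) / 2) + 5 + 3 * ((a + 1) % 2) - b) / 2) ?_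
        have := vertexWalk_cases ((a + 1) % 2) ((-a - 1) / 2)
          ((10 * ((-a - 1) / 2) + 5 + 3 * ((a + 1) % 2) - b) / 2)
        omega
    · right
      have main : ∀ l, (l = b ∨ l = b - 1) → (a - b < 0 → l % 2 = 0) →
          (0 < a - b → l % 2 = 1) → InPerfect (intPoint (a, b)) := by
        intro l hl h1 h2
        refine perf l hl fun h i h0 i1 i2 hi => ?_
        have := hexLabel_cases h i
        rw [hi] at this
        omega
      by_cases hs : a - b < 0
      · exact main (if b % 2 = 0 then b else b - 1) (by split_ifs <;> simp)
          (by split_ifs <;> omega) (by omega)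
      · exact main (if b % 2 = 1 then b else b - 1) (by split_ifs <;> simp)
          (by omega) (by split_ifs <;> omega)
  · by_cases hp : (a - b) % 2 = 0
    · right
      have main : ∀ l, (l = b ∨ l = b - 1) → l % 2 = 0 → InPerfect (intPoint (a, b)) := by
        intro l hl h1
        refine perf l hl fun h i h0 i1 i2 hi => ?_
        have := hexLabel_cases h i
        rw [hi] at this
        omega
      exact main (if b % 2 = 0 then b else b - 1) (by split_ifs <;> simp) (by split_ifs <;> omega)
    · left
      by_cases hb : b < 0 ∨ (b ≤ 1 ∧ b < a)
      · refine aux ((a + 1) % 2) ((a - b - 1) / 2) ((a + (a - b) + (a + 1) % 2) / 2) ?_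
        have := vertexWalk_cases ((a + 1) % 2) ((a - b - 1) / 2)
          ((a + (a - b) + (a + 1) % 2) / 2)
        omega
      · by_cases ha : a < 0
        · refine aux ((b + 1) % 2) ((b - a - 1) / 2)
            ((4 * (b - a) + 3 * ((b + 1) % 2) - a) / 2) ?_
          have := vertexWalk_cases ((b + 1) % 2) ((b - a - 1) / 2)
            ((4 * (b - a) + 3 * ((b + 1) % 2) - a) / 2)
          omega
        · by_cases hab : b < a
          · refine aux ((a + 1) % 2) ((a - 1) / 2)
              ((b + (4 * ((a - 1) / 2) + 2 + (a + 1) % 2)) / 2) ?_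
            have := vertexWalk_cases ((a + 1) % 2) ((a - 1) / 2)
              ((b + (4 * ((a - 1) / 2) + 2 + (a + 1) % 2)) / 2)
            omega
          · refine aux ((b + 1) % 2) ((b - 1) / 2)
              ((8 * ((b - 1) / 2) + 4 + 3 * ((b + 1) % 2) - a) / 2) ?_
            have := vertexWalk_cases ((b + 1) % 2) ((b - 1) / 2)
              ((8 * ((b - 1) / 2) + 4 + 3 * ((b + 1) % 2) - a) / 2)
            omega


/-! ### The critical set -/

/-- Perfect hexagons are forward invariant. The iterate is periodic, so by injectivity `q` is itself
a forward iterate of it. -/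
theorem inPerfect_of_iterate {q : ℝ × ℝ} {t : ℕ} (h : InPerfect (latticeMap^[t] q)) :
    InPerfect q := by
  obtain ⟨n, i, w, hi, hw, hq⟩ := h
  have hper : ∀ s : ℕ, latticeMap^[(36 * n + 6) * s] (latticeMap^[t] q) = latticeMap^[t] q := by
    intro s
    rw [hq, iterate_hexPoint_of_odd hi hw, rot_iterate_of_dvd ⟨(6 * n + 1) * s, by ring⟩,
      ringHex_congr (j := i) ⟨6 * n * s, by push_cast; ring⟩]
  have hle : t ≤ (36 * n + 6) * t := Nat.le_mul_of_pos_left _ (by omega)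
  have key : latticeMap^[(36 * n + 6) * t - t] (latticeMap^[t] q) = q := by
    apply latticeMap_injective.iterate t
    rw [← Function.iterate_add_apply, Nat.add_sub_cancel' hle, hper]
  rw [← key, hq, iterate_hexPoint_of_odd hi hw]
  exact ⟨n, _, _, by rw [Int.odd_iff] at *; rw [mul_assoc]; omega, hw.iterate_rot _, rfl⟩

theorem minimalPeriod_intPoint {c : ℤ × ℤ} (h : ¬ InPerfect (intPoint c)) :
    ∃ n : ℕ, Function.minimalPeriod latticeMap (intPoint c) = 18 * n + 9 ∨
      Function.minimalPeriod latticeMap (intPoint c) = 18 * n + 15 := by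
  obtain ⟨e, n, j, he, hj, rfl⟩ := (exists_vertexWalk_or_inPerfect c).resolve_right h
  refine ⟨n, ?_⟩
  rw [minimalPeriod_vertexWalk he hj]
  omega

theorem exists_int_of_half {a : ℝ} {k : ℤ} (h : a = k + 1 / 2) (v : ℝ) :
    ∃ m : ℤ, -a + sgn v / 2 = m := by
  unfold sgn
  split_ifs
  · exact ⟨-k, by rw [h]; push_cast; ring⟩
  · exact ⟨-k - 1, by rw [h]; push_cast; ring⟩

theorem exists_int_of_half_add {a : ℝ} {k : ℤ} (h : a = k + 1 / 2) (v : ℝ) :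
    ∃ m : ℤ, a + sgn v / 2 = m := by
  unfold sgn
  split_ifs
  · exact ⟨k + 1, by rw [h]; push_cast; ring⟩
  · exact ⟨k, by rw [h]; ring⟩

/-- The map permutes the three kinds of crossings cyclically, so at most two steps lead to the
integer kind. -/
theorem exists_iterate_eq_intPoint {q : ℝ × ℝ} (hq : IsCrossing q) :
    ∃ t c, latticeMap^[t] q = intPoint c := by
  obtain ⟨v, d⟩ := q
  obtain ⟨l, m, h1, h2⟩ | ⟨l, k, h1, h2⟩ | ⟨m, k, h1, h2⟩ := hq <;> dsimp only at h1 h2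
  · exact ⟨0, (m, l), by simp [intPoint, h1, h2]⟩
  · obtain ⟨a, ha⟩ := exists_int_of_half h2 v
    refine ⟨1, (l, a), Prod.ext ?_ ?_⟩
    · simp only [Function.iterate_one, latticeMap, intPoint]; linarith
    · simp only [Function.iterate_one, latticeMap, intPoint]; exact h1
  · obtain ⟨a, ha⟩ := exists_int_of_half h2 v
    have hv : -v = (k - m : ℤ) + 1 / 2 := by push_cast; linarith
    obtain ⟨b, hb⟩ := exists_int_of_half_add hv (v - d + sgn v / 2)
    refine ⟨2, (a, a + b), Prod.ext ?_ ?_⟩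
    · simp only [Function.iterate_succ_apply, Function.iterate_zero, id, latticeMap, intPoint]
      push_cast; linarith
    · simp only [Function.iterate_succ_apply, Function.iterate_zero, id, latticeMap, intPoint]
      linarith

theorem minimalPeriod_of_isCrossing {q : ℝ × ℝ} (hq : IsCrossing q) (h : ¬ InPerfect q) :
    ∃ n : ℕ, Function.minimalPeriod latticeMap q = 18 * n + 9 ∨
      Function.minimalPeriod latticeMap q = 18 * n + 15 := by
  obtain ⟨t, c, hc⟩ := exists_iterate_eq_intPoint hq
  rw [← minimalPeriod_iterate_of_injective latticeMap_injective t, hc]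
  exact minimalPeriod_intPoint fun hp => h (inPerfect_of_iterate (t := t) (hc ▸ hp))

/-- The point with lattice coordinates `q` lies on a grid line. -/
def OnGrid (q : ℝ × ℝ) : Prop :=
  (∃ l : ℤ, q.1 = l) ∨ (∃ m : ℤ, q.2 = m) ∨ (∃ k : ℤ, q.2 - q.1 = k + 1 / 2)

theorem onGrid_of_latticeMap {q : ℝ × ℝ} (h : OnGrid (latticeMap q)) : OnGrid q := by
  have half : ∃ c : ℤ, sgn q.1 / 2 = c + 1 / 2 := by
    unfold sgn
    split_ifs
    · exact ⟨0, by norm_num⟩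
    · exact ⟨-1, by norm_num⟩
  obtain ⟨c, hc⟩ := half
  simp only [OnGrid, latticeMap, hc] at h
  obtain ⟨a, ha⟩ | ⟨a, ha⟩ | ⟨a, ha⟩ := h
  · exact .inr (.inr ⟨c - a, by push_cast; linarith⟩)
  · exact .inl ⟨a, ha⟩
  · exact .inr (.inl ⟨a + c + 1, by push_cast; linarith⟩)

theorem onGrid_of_iterate {q : ℝ × ℝ} {t : ℕ} (h : OnGrid (latticeMap^[t] q)) : OnGrid q := by
  induction t with
  | zero => exact h
  | succ t ih => rw [Function.iterate_succ_apply'] at h; exact ih (onGrid_of_latticeMap h)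

theorem onGrid_of_mem_criticalSet {p : ℝ × ℝ} (hp : p ∈ criticalSet (Real.pi / 3)) :
    OnGrid (toLattice p) := by
  obtain ⟨i, hi⟩ := Set.mem_iUnion.1 hp
  have hi : ((F (Real.pi / 3))^[i] p).2 = 0 := hi
  rw [← ofLattice_toLattice p, iterate_F_ofLattice] at hi
  have h0 := (mul_eq_zero.1 hi).resolve_left sqrt_three_pos.ne'
  exact onGrid_of_iterate (t := i) (.inl ⟨0, by rw [h0]; simp⟩)

theorem onGrid_of_mem {p : ℝ × ℝ} {L : Set (ℝ × ℝ)} (hL : IsGridLine L) (hp : p ∈ L) :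
    OnGrid (toLattice p) := by
  obtain ⟨a, rfl⟩ | ⟨a, rfl⟩ | ⟨a, rfl⟩ := hL
  · exact .inr (.inr ⟨a, mem_lineUp_iff.1 hp⟩)
  · exact .inl ⟨a, mem_lineHor_iff.1 hp⟩
  · exact .inr (.inl ⟨a, mem_lineDown_iff.1 hp⟩)

/-! ### From grid points to hexagons. -/

theorem exists_hexPoint_of_onGrid {q : ℝ × ℝ} (hq : OnGrid q) :
    ∃ c w, InHex w ∧ q = hexPoint c w := by
  obtain ⟨v, d⟩ := q
  have build : ∀ k l : ℤ, InHex (v - (l + 1 / 2), d - (k + l + 1 / 2)) →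
      ∃ c w, InHex w ∧ (v, d) = hexPoint c w := fun k l h =>
    ⟨(k, l), _, h, by simp [hexPoint]⟩
  obtain ⟨a, ha⟩ | ⟨a, ha⟩ | ⟨a, ha⟩ := hq <;> dsimp only at ha
  · have h1 := Int.floor_le d
    have h2 := Int.lt_floor_add_one d
    -- Along a grid line the edges have length `1/2` in the running coordinate, and the adjacent
    -- hexagon lies alternately on either side.
    by_cases h : d ≤ ⌊d⌋ + 1 / 2
    · refine build (⌊d⌋ - a) a ⟨⟨?_, ?_⟩, ⟨?_, ?_⟩, ?_, ?_⟩ <;> push_cast <;> linarith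
    · refine build (⌊d⌋ - a + 1) (a - 1) ⟨⟨?_, ?_⟩, ⟨?_, ?_⟩, ?_, ?_⟩ <;> push_cast <;> linarith
  · have h1 := Int.floor_le v
    have h2 := Int.lt_floor_add_one v
    by_cases h : v ≤ ⌊v⌋ + 1 / 2
    · refine build (a - ⌊v⌋) ⌊v⌋ ⟨⟨?_, ?_⟩, ⟨?_, ?_⟩, ?_, ?_⟩ <;> push_cast <;> linarith
    · refine build (a - 1 - ⌊v⌋) ⌊v⌋ ⟨⟨?_, ?_⟩, ⟨?_, ?_⟩, ?_, ?_⟩ <;> push_cast <;> linarith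
  · have h1 := Int.floor_le v
    have h2 := Int.lt_floor_add_one v
    by_cases h : v ≤ ⌊v⌋ + 1 / 2
    · refine build a ⌊v⌋ ⟨⟨?_, ?_⟩, ⟨?_, ?_⟩, ?_, ?_⟩ <;> push_cast <;> linarith
    · refine build (a + 1) ⌊v⌋ ⟨⟨?_, ?_⟩, ⟨?_, ?_⟩, ?_, ?_⟩ <;> push_cast <;> linarith

theorem abs_eq_half_of_int {a b : ℤ} {x : ℝ} (h : b + 1 / 2 + x = a) (h1 : -(1 / 2) ≤ x)
    (h2 : x ≤ 1 / 2) : |x| = 1 / 2 := by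
  have e1 : (b : ℝ) ≤ a := by linarith
  have e2 : (a : ℝ) ≤ b + 1 := by linarith
  have e1 : b ≤ a := by exact_mod_cast e1
  have e2 : a ≤ b + 1 := by exact_mod_cast e2
  obtain rfl | rfl : a = b ∨ a = b + 1 := by omega
  · rw [show x = -(1 / 2) by linarith, abs_neg, abs_of_pos (by norm_num)]
  · rw [show x = 1 / 2 by push_cast at h; linarith, abs_of_pos (by norm_num)]

theorem abs_eq_half_of_onGrid {c : ℤ × ℤ} {w : ℝ × ℝ} (hw : InHex w)
    (h : OnGrid (hexPoint c w)) : (|w.1| = 1 / 2 ∨ |w.2| = 1 / 2) ∨ |w.1 - w.2| = 1 / 2 := by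
  obtain ⟨⟨h1, h2⟩, ⟨h3, h4⟩, h5, h6⟩ := hw
  simp only [OnGrid, hexPoint] at h
  obtain ⟨a, ha⟩ | ⟨a, ha⟩ | ⟨a, ha⟩ := h
  · exact .inl (.inl (abs_eq_half_of_int ha h1 h2))
  · exact .inl (.inr (abs_eq_half_of_int (b := c.1 + c.2) (by push_cast; exact ha) h3 h4))
  · exact .inr (abs_eq_half_of_int (a := 0) (b := a - c.1) (by push_cast; linarith) h5 h6)

theorem minimalPeriod_of_onGrid {q : ℝ × ℝ} (hq : OnGrid q) (hv : ¬ IsCrossing q)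
    (hnp : ¬ InPerfect q) : ∃ n : ℕ, Function.minimalPeriod latticeMap q = 108 * n + 72 := by
  obtain ⟨⟨k, l⟩, w, hw, rfl⟩ := exists_hexPoint_of_onGrid hq
  obtain ⟨h, i, h0, h1, h2, h3⟩ := exists_hexLabel k l
  rw [← h3, ← ringHex_eq_hexLabel h1 h2] at hq hv hnp ⊢
  obtain ⟨j, u, hu, rfl⟩ := exists_isTop_of_openEdge hw hv (abs_eq_half_of_onGrid hw hq)
  lift h to ℕ using h0
  obtain ⟨n, rfl | rfl⟩ := Nat.even_or_odd' h
  · obtain hi | hi := Int.even_or_odd i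
    · push_cast
      exact minimalPeriod_edge_even n hi j hu
    · exact absurd ⟨n, i, _, hi, hw, by push_cast; rfl⟩ hnp
  · refine ⟨n, ?_⟩
    push_cast
    exact minimalPeriod_edge_odd n i j hu

theorem ne_zero_of_onGrid {c : ℤ × ℤ} {w : ℝ × ℝ} (hw : InHex w) (h : OnGrid (hexPoint c w)) :
    w ≠ 0 := by
  rintro rfl
  have := abs_eq_half_of_onGrid hw h
  norm_num at this

theorem mem_periodicPts_of_onGrid {q : ℝ × ℝ} (hq : OnGrid q) :
    q ∈ Function.periodicPts latticeMap := by
  rw [← Function.minimalPeriod_pos_iff_mem_periodicPts]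
  by_cases hp : InPerfect q
  · obtain ⟨n, i, w, hi, hw, rfl⟩ := hp
    obtain ⟨j, h1, h2, r, hr⟩ := exists_index (2 * n) i (by omega)
    have hj : Odd j := by
      rw [Int.odd_iff] at *
      have : (6 * (2 * (n : ℤ)) + 2) * r = 2 * ((6 * n + 1) * r) := by ring
      omega
    rw [ringHex_congr ⟨r, hr⟩] at hq ⊢
    rw [minimalPeriod_perfect h1 hj hw (ne_zero_of_onGrid hw hq)]
    omega
  · by_cases hv : IsCrossing q
    · obtain ⟨n, h | h⟩ := minimalPeriod_of_isCrossing hv hp <;> omega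
    · obtain ⟨n, h⟩ := minimalPeriod_of_onGrid hq hv hp
      omega

theorem exists_isPerfectHexagon {p : ℝ × ℝ} (h : InPerfect (toLattice p)) :
    ∃ (n : ℕ) (k l : ℤ), IsPerfectHexagon n k l ∧ p ∈ closedTile k l (k + l) := by
  obtain ⟨n, i, w, hi, hw, h⟩ := h
  exact ⟨n, _, _, isPerfectHexagon_ringHex hi, mem_hexagon_iff.2 ⟨w, hw, h⟩⟩

end PiecewiseRotation

open PiecewiseRotation in
theorem theoremt :
    (∀ p ∈ criticalSet (Real.pi / 3), p ∈ Function.periodicPts (F (Real.pi / 3))) ∧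
    (∀ (n : ℕ) (k l : ℤ) (e : Set (ℝ × ℝ)), IsPerfectHexagon n k l → IsEdge k l (k + l) e →
      ∀ p ∈ e, Function.minimalPeriod (F (Real.pi / 3)) p = 36 * n + 6) ∧
    (∀ (k l m : ℤ) (e : Set (ℝ × ℝ)), IsEdge k l m e → ¬ IsPerfectEdge e →
      ∀ p ∈ openEdge k l m e,
        ∃ n : ℕ, Function.minimalPeriod (F (Real.pi / 3)) p = 108 * n + 72) ∧
    (∀ (k l m : ℤ) (p : ℝ × ℝ), IsVertex k l m p → ¬ IsPerfectVertex p →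
      ∃ n : ℕ, Function.minimalPeriod (F (Real.pi / 3)) p = 18 * n + 9 ∨
        Function.minimalPeriod (F (Real.pi / 3)) p = 18 * n + 15) := by
  refine ⟨fun p hp => ?_, ?_, ?_, ?_⟩
  · rw [← Function.minimalPeriod_pos_iff_mem_periodicPts, minimalPeriod_F,
      Function.minimalPeriod_pos_iff_mem_periodicPts]
    exact mem_periodicPts_of_onGrid (onGrid_of_mem_criticalSet hp)
  · rintro n k l _ ⟨-, i, h1, h2, hi, hil⟩ ⟨L, hL, rfl, -⟩ p ⟨hp, hpL⟩
    obtain ⟨w, hw, hpw⟩ := mem_hexagon_iff.1 hp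
    have hg := onGrid_of_mem hL hpL
    rw [minimalPeriod_F]
    rw [hpw] at hg ⊢
    rw [← hil, ← ringHex_eq_hexLabel h1 (by omega)]
    exact minimalPeriod_perfect h1 hi hw (ne_zero_of_onGrid hw hg)
  · rintro k l m _ ⟨L, hL, rfl, hne⟩ hperf p ⟨⟨hp, hpL⟩, hv⟩
    have hv : ¬ IsCrossing (toLattice p) := fun h => hv (isVertex_iff.2 ⟨hp, h⟩)
    rw [minimalPeriod_F]
    refine minimalPeriod_of_onGrid (onGrid_of_mem hL hpL) hv fun h => hperf ?_
    obtain ⟨n, k', l', hh, hp'⟩ := exists_isPerfectHexagon h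
    -- The edge may have been given through another tile, such as a triangle; it is the same subset
    -- of `L` as the edge of the perfect hexagon.
    exact ⟨n, k', l', hh, L, hL, Set.Subset.antisymm
      (closedTile_inter_subset hL hpL hv hp hp') (closedTile_inter_subset hL hpL hv hp' hp), hne⟩
  · intro k l m p hv hperf
    rw [minimalPeriod_F]
    obtain ⟨-, hc⟩ := isVertex_iff.1 hv
    refine minimalPeriod_of_isCrossing hc fun h => hperf ?_
    obtain ⟨n, k', l', hh, hp'⟩ := exists_isPerfectHexagon h
    exact ⟨n, k', l', hh, isVertex_iff.2 ⟨hp', hc⟩⟩
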